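/- Let $l\ge 1$, $\rho>0$, $\mathbb T=\mathbb R/\mathbb Z$ and $\Delta_\rho=\{z\in\mathbb C/\mathbb Z:\ |\operatorname{Im}z|\le\rho\}$. Let $v_1,\dots,v_l$ be nonconstant real analytic functions on $\mathbb T$ that extend analytically to (a neighbourhood of) $\Delta_\rho$, and put $V=\mathrm{diag}(v_1,\dots,v_l)$. For $\epsilon>0$, $\omega\in\mathbb R$ and matrices $W_k\in\mathbb C^{l\times l}$ ($k\in\mathbb Z$) with $W_{-k}=W_k^*$ (adjoint) and $\|W_k\|\le e^{-\rho|k|}$ (Euclidean operator norm), consider $$(H(x)\vec\psi)_n=\epsilon\sum_{k\in\mathbb Z}W_k\vec\psi_{n-k}+V(x+n\omega)\vec\psi_n ,\qquad \vec\psi\in\ell^2(\mathbb Z,\mathbb C^l),$$ and let $H_N(x)$ be the restriction of $H(x)$ to the sites $1,\dots,N$, an $Nl\times Nl$ matrix. For $t>0$ let $\mathrm{DC}_t=\{\omega\in\mathbb R:\ \operatorname{dist}(k\omega,\mathbb Z)\ge t/|k|^2\ \ \forall k\in\mathbb Z\setminus\{0\}\}$. Let $$\Sigma=\sum_{j=1}^l\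 \sup_{E\in\mathbb R}\#\{\text{zeros of } v_j-E \text{ in } \Delta_\rho,\ \text{counted with multiplicity}\}.$$ Then $0<\Sigma<\infty$, and there are $\epsilon_0=\epsilon_0(V,\rho,l)>0$ and $C=C(V,\rho)>0$ such that for every $0<\epsilon\le\epsilon_0$ and every $t>0$ there is $N_0=N_0(V,l,\epsilon,\rho,t)$ with the following property. For all $\omega\in\mathrm{DC}_t$, all $(W_k)_{k\in\mathbb Z}$ as above, all $E$ in any compact interval of $\mathbb R$ (the constants do not depend on the interval), and all $N\ge N_0$: $\det(H_N(x)-E)\ne0$ for almost every $x$, the functions $\log|\det(H_N(x)-E)|$ and $\log|v_j(x)-E|$ are integrable on $\mathbb T$, and $$\frac1N\int_{\mathbb T}\log|\det(H_N(x)-E)|\,dx\ \ge\ \sum_{j=1}^l\int_{\mathbb T}\log|v_j(x)-E|\,dx-C\,l\,\epsilon^{1/(2\Sigma)} .$$ -/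

import Mathlib

/-- The closed strip `{z : |Im z| ≤ ρ}` in the complex plane. -/
def closedStrip (ρ : ℝ) : Set ℂ := {z : ℂ | |z.im| ≤ ρ}

/-- The fundamental domain `{z : 0 ≤ Re z < 1, |Im z| ≤ ρ}` of the closed strip modulo `ℤ`. -/
def periodStrip (ρ : ℝ) : Set ℂ := {z : ℂ | 0 ≤ z.re ∧ z.re < 1 ∧ |z.im| ≤ ρ}

/-- `f` is (the complex extension of) a nonconstant real analytic function on `ℝ/ℤ` that is
analytic on the closed strip of half-width `ρ`, that is, on a neighbourhood of it. -/
structure IsPotential (ρ : ℝ) (f : ℂ → ℂ) : Prop where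
  analytic : AnalyticOnNhd ℂ f (closedStrip ρ)
  periodic : ∀ z ∈ closedStrip ρ, f (z + 1) = f z
  real : ∀ x : ℝ, (f x).im = 0
  nonconstant : ∃ x y : ℝ, f x ≠ f y

/-- The number in `ℕ ∪ {∞}` of zeros of `f - E`, counted with multiplicity, on the closed strip
modulo `ℤ`: the supremum of the sums of the orders of vanishing over finite sets of points. -/
noncomputable def zeroCount (ρ : ℝ) (f : ℂ → ℂ) (E : ℝ) : ℕ∞ :=
  ⨆ (s : Finset ℂ) (_ : (s : Set ℂ) ⊆ periodStrip ρ),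
    ∑ z ∈ s, analyticOrderAt (fun w : ℂ => f w - (E : ℂ)) z

/-- The sum over `j` of the supremum over `E ∈ ℝ` of the number of zeros of `v j - E`. -/
noncomputable def zeroBound {l : ℕ} (ρ : ℝ) (v : Fin l → ℂ → ℂ) : ℕ∞ :=
  ∑ j, ⨆ E : ℝ, zeroCount ρ (v j) E

/-- The set of `ω` whose nonzero integer multiples `k ω` are at distance at least `t / k ^ 2`
from the integers (the norm on `UnitAddCircle` is the distance to the nearest integer). -/
def DC (t : ℝ) : Set ℝ :=
  {ω : ℝ | ∀ k : ℤ, k ≠ 0 → t / |(k : ℝ)| ^ 2 ≤ ‖(((k : ℝ) * ω : ℝ) : UnitAddCircle)‖}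

/-- Hopping matrices: `W (-k)` is the adjoint of `W k`, and the Euclidean operator norm of
`W k` is at most `exp (-ρ |k|)`. -/
structure IsHopping {l : ℕ} (ρ : ℝ) (W : ℤ → Matrix (Fin l) (Fin l) ℂ) : Prop where
  adjoint : ∀ k : ℤ, W (-k) = (W k).conjTranspose
  decay : ∀ k : ℤ, ‖Matrix.toEuclideanCLM (𝕜 := ℂ) (W k)‖ ≤ Real.exp (-ρ * |(k : ℝ)|)

/-- The infinite block matrix of the operator
`(H ψ) n = ε ∑ k, W k (ψ (n - k)) + V (z + n ω) (ψ n)` with `V = diag (v 1, …, v l)`: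
its `(n, n')` block is `ε W (n - n')`, plus `V (z + n ω)` when `n = n'`. -/
noncomputable def blockEntry {l : ℕ} (ε ω : ℝ) (W : ℤ → Matrix (Fin l) (Fin l) ℂ)
    (v : Fin l → ℂ → ℂ) (z : ℂ) (n n' : ℤ) : Matrix (Fin l) (Fin l) ℂ :=
  (ε : ℂ) • W (n - n') +
    if n = n' then Matrix.diagonal (fun j => v j (z + (n : ℂ) * (ω : ℂ))) else 0

/-- The restriction `H_N` to the sites `1, …, N`, a matrix of size `N l`; the site of the index
`(i, j)` with `i : Fin N` is `i + 1`. -/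
noncomputable def dirichletMatrix {l : ℕ} (ε ω : ℝ) (W : ℤ → Matrix (Fin l) (Fin l) ℂ)
    (v : Fin l → ℂ → ℂ) (N : ℕ) (z : ℂ) : Matrix (Fin N × Fin l) (Fin N × Fin l) ℂ :=
  Matrix.of fun p q =>
    blockEntry ε ω W v z (((p.1 : ℕ) : ℤ) + 1) (((q.1 : ℕ) : ℤ) + 1) p.2 q.2

/-- The Dirichlet determinant `det (H_N - E)`. -/
noncomputable def dirichletDet {l : ℕ} (ε ω : ℝ) (W : ℤ → Matrix (Fin l) (Fin l) ℂ)
    (v : Fin l → ℂ → ℂ) (N : ℕ) (E : ℝ) (z : ℂ) : ℂ :=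
  (dirichletMatrix ε ω W v N z - (E : ℂ) • (1 : Matrix (Fin N × Fin l) (Fin N × Fin l) ℂ)).det

/-! The mean of `log |F|` over a horizontal line is a convex function of the height
(`logMean_convex`), so a lower bound on a line slightly above the real axis, combined with an upper
bound on a fixed higher line, gives a lower bound on the axis (`sub_le_logMean_zero`).

The lower bound comes from a line on which every `v j - E` is large. Near a real point, `f - E`
dominates a product of at most `S` distances, with a constant independent of `E`. Hence there is a
height `y < δ` at which `|v j - E| ≥ c δ^S (1 + |E|)` for all `j` (`exists_good_line`). With `δ =
ε^(1/(2S))` the hopping has size of order `δ^(2S)`, a fraction at most of order `δ` of the diagonal.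
By Gershgorin the determinant is then comparable to the product of the diagonal entries, up to an
error of order `δ` per index in the logarithm (`le_logMean_dirichletDet`).

The mean of `log |v j - E|` is convex and even in the height, so it is smallest on the axis; passing
to the line costs nothing for the potentials. Bringing the determinant back to the axis costs at
most `2y/δ₀` times the gap between the upper and lower bounds. This gap is `O(N l)` uniformly in
`E`, because the contributions `log (1 + |E|)` cancel (`exists_log_sub_le_logMean`). Both losses are
of order `l δ` per site. -/

/-! ### Periodic analytic functions on the strip and their logarithmic means. -/

/-- Functions that are analytic on a neighbourhood of the closed strip and `1`-periodic on it. -/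
structure IsStripAnalytic (ρ : ℝ) (F : ℂ → ℂ) : Prop where
  analytic : AnalyticOnNhd ℂ F (closedStrip ρ)
  periodic : ∀ z ∈ closedStrip ρ, F (z + 1) = F z

/-- The mean of `log |F|` over one period of the horizontal line of height `y`. -/
noncomputable def logMean (F : ℂ → ℂ) (y : ℝ) : ℝ :=
  ∫ x in (0 : ℝ)..1, Real.log ‖F ((x : ℂ) + (y : ℂ) * Complex.I)‖

theorem mem_closedStrip {ρ : ℝ} {z : ℂ} : z ∈ closedStrip ρ ↔ |z.im| ≤ ρ := Iff.rfl

theorem line_mem_closedStrip {ρ y : ℝ} (hy : |y| ≤ ρ) (x : ℝ) :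
    (x : ℂ) + (y : ℂ) * Complex.I ∈ closedStrip ρ := by
  simpa [mem_closedStrip] using hy

theorem add_ofReal_mem_closedStrip {ρ : ℝ} {z : ℂ} (hz : z ∈ closedStrip ρ) (x : ℝ) :
    z + (x : ℂ) ∈ closedStrip ρ := by
  simpa [mem_closedStrip] using hz

theorem convex_closedStrip (ρ : ℝ) : Convex ℝ (closedStrip ρ) := by
  have h : closedStrip ρ = Complex.imLm ⁻¹' (Set.Icc (-ρ) ρ) := by
    ext z
    simp [mem_closedStrip, abs_le]
  rw [h]
  exact (convex_Icc (-ρ) ρ).linear_preimage _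

theorem isPreconnected_closedStrip (ρ : ℝ) : IsPreconnected (closedStrip ρ) :=
  (convex_closedStrip ρ).isPreconnected

theorem IsPotential.isStripAnalytic {ρ : ℝ} {f : ℂ → ℂ} (hf : IsPotential ρ f) :
    IsStripAnalytic ρ f := ⟨hf.analytic, hf.periodic⟩

namespace IsStripAnalytic

variable {ρ : ℝ} {F : ℂ → ℂ}

theorem sub_const (hF : IsStripAnalytic ρ F) (c : ℂ) : IsStripAnalytic ρ (fun z => F z - c) :=
  ⟨hF.analytic.sub analyticOnNhd_const, fun z hz => by simp only [hF.periodic z hz]⟩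

theorem comp_add_ofReal (hF : IsStripAnalytic ρ F) (a : ℝ) :
    IsStripAnalytic ρ (fun z => F (z + (a : ℂ))) := by
  refine ⟨fun z hz => ?_, fun z hz => ?_⟩
  · exact (hF.analytic _ (add_ofReal_mem_closedStrip hz a)).comp_of_eq
      (analyticAt_id.add analyticAt_const) rfl
  · have := hF.periodic _ (add_ofReal_mem_closedStrip hz a)
    rw [← this]
    ring_nf

theorem finset_prod {ι : Type*} {s : Finset ι} {G : ι → ℂ → ℂ}
    (h : ∀ i ∈ s, IsStripAnalytic ρ (G i)) : IsStripAnalytic ρ (fun z => ∏ i ∈ s, G i z) :=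
  ⟨fun z hz => s.analyticAt_fun_prod fun i hi => (h i hi).analytic z hz,
    fun z hz => Finset.prod_congr rfl fun i hi => (h i hi).periodic z hz⟩

theorem finset_sum {ι : Type*} {s : Finset ι} {G : ι → ℂ → ℂ}
    (h : ∀ i ∈ s, IsStripAnalytic ρ (G i)) : IsStripAnalytic ρ (fun z => ∑ i ∈ s, G i z) :=
  ⟨fun z hz => s.analyticAt_fun_sum fun i hi => (h i hi).analytic z hz,
    fun z hz => Finset.sum_congr rfl fun i hi => (h i hi).periodic z hz⟩

theorem const_mul (hF : IsStripAnalytic ρ F) (c : ℂ) : IsStripAnalytic ρ (fun z => c * F z) :=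
  ⟨analyticOnNhd_const.mul hF.analytic, fun z hz => by simp only [hF.periodic z hz]⟩

theorem const_add (hF : IsStripAnalytic ρ F) (c : ℂ) : IsStripAnalytic ρ (fun z => c + F z) :=
  ⟨analyticOnNhd_const.add hF.analytic, fun z hz => by simp only [hF.periodic z hz]⟩

theorem const (c : ℂ) : IsStripAnalytic ρ (fun _ => c) :=
  ⟨analyticOnNhd_const, fun _ _ => rfl⟩

theorem matrix_det {ι : Type*} [Fintype ι] [DecidableEq ι] {A : ℂ → Matrix ι ι ℂ}
    (h : ∀ i j, IsStripAnalytic ρ (fun z => A z i j)) : IsStripAnalytic ρ (fun z => (A z).det) := by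
  simp only [Matrix.det_apply']
  exact finset_sum fun σ _ => (finset_prod fun i _ => h _ _).const_mul _

theorem add_nat (hF : IsStripAnalytic ρ F) {z : ℂ} (hz : z ∈ closedStrip ρ) (n : ℕ) :
    F (z + n) = F z := by
  induction n with
  | zero => simp
  | succ n ih =>
    have h := hF.periodic _ (add_ofReal_mem_closedStrip hz n)
    push_cast at h ⊢
    rw [← add_assoc, h, ih]

theorem add_int (hF : IsStripAnalytic ρ F) {z : ℂ} (hz : z ∈ closedStrip ρ) (n : ℤ) :
    F (z + n) = F z := by
  obtain ⟨m, rfl | rfl⟩ := n.eq_nat_or_neg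
  · exact_mod_cast hF.add_nat hz m
  · have h := hF.add_nat (add_ofReal_mem_closedStrip hz (-m : ℝ)) m
    push_cast at h ⊢
    rw [← h]
    simp

theorem continuous_line (hF : IsStripAnalytic ρ F) {y : ℝ} (hy : |y| ≤ ρ) :
    Continuous fun x : ℝ => F ((x : ℂ) + (y : ℂ) * Complex.I) := by
  refine continuous_iff_continuousAt.2 fun x => ?_
  exact ContinuousAt.comp (f := fun x : ℝ => (x : ℂ) + (y : ℂ) * Complex.I)
    (hF.analytic _ (line_mem_closedStrip hy x)).continuousAt (by fun_prop)

theorem periodic_line (hF : IsStripAnalytic ρ F) {y : ℝ} (hy : |y| ≤ ρ) :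
    Function.Periodic (fun x : ℝ => F ((x : ℂ) + (y : ℂ) * Complex.I)) 1 := by
  intro x
  simp only
  rw [← hF.periodic _ (line_mem_closedStrip hy x)]
  push_cast
  ring_nf

theorem analyticAt_line (hF : IsStripAnalytic ρ F) {y : ℝ} (hy : |y| ≤ ρ) (x : ℝ) :
    AnalyticAt ℝ (fun x : ℝ => F ((x : ℂ) + (y : ℂ) * Complex.I)) x := by
  have h1 : AnalyticAt ℝ (fun x : ℝ => (x : ℂ) + (y : ℂ) * Complex.I) x :=
    (Complex.ofRealCLM.analyticAt x).add analyticAt_const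
  exact ((hF.analytic _ (line_mem_closedStrip hy x)).restrictScalars (𝕜 := ℝ)).comp_of_eq h1 rfl

theorem intervalIntegrable_log (hF : IsStripAnalytic ρ F) {y : ℝ} (hy : |y| ≤ ρ) (a b : ℝ) :
    IntervalIntegrable (fun x : ℝ => Real.log ‖F ((x : ℂ) + (y : ℂ) * Complex.I)‖)
      MeasureTheory.volume a b :=
  MeromorphicOn.intervalIntegrable_log_norm fun x _ => (hF.analyticAt_line hy x).meromorphicAt

/-- Identity theorem, used twice: zeros on a line are discrete unless `F` vanishes on the whole
line, and then `F` vanishes on the whole strip. -/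
theorem ae_ne_zero (hF : IsStripAnalytic ρ F) (h0 : ∃ z ∈ closedStrip ρ, F z ≠ 0) {y : ℝ}
    (hy : |y| ≤ ρ) : ∀ᵐ x : ℝ, F ((x : ℂ) + (y : ℂ) * Complex.I) ≠ 0 := by
  have hA : AnalyticOnNhd ℝ (fun x : ℝ => F ((x : ℂ) + (y : ℂ) * Complex.I)) Set.univ :=
    fun x _ => hF.analyticAt_line hy x
  rcases hA.eqOn_zero_or_eventually_ne_zero_of_preconnected isPreconnected_univ with h | h
  · exfalso
    obtain ⟨z, hz, hz0⟩ := h0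
    refine hz0 (hF.analytic.eqOn_zero_of_preconnected_of_frequently_eq_zero
      (isPreconnected_closedStrip ρ) (line_mem_closedStrip hy 0) ?_ hz)
    have ht : Filter.Tendsto (fun x : ℝ => (x : ℂ) + (y : ℂ) * Complex.I) (nhdsWithin 0 {0}ᶜ)
        (nhdsWithin (((0 : ℝ) : ℂ) + (y : ℂ) * Complex.I)
          {((0 : ℝ) : ℂ) + (y : ℂ) * Complex.I}ᶜ) := by
      refine tendsto_nhdsWithin_iff.2 ⟨?_, ?_⟩
      · exact (Continuous.tendsto (by fun_prop) 0).mono_left nhdsWithin_le_nhds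
      · filter_upwards [self_mem_nhdsWithin] with x hx
        simpa using hx
    exact ht.frequently (Filter.Eventually.frequently (.of_forall fun x => h (Set.mem_univ x)))
  · have := ae_restrict_le_codiscreteWithin (μ := MeasureTheory.volume) MeasurableSet.univ h
    rw [MeasureTheory.Measure.restrict_univ] at this
    exact this

theorem exists_norm_le (hF : IsStripAnalytic ρ F) :
    ∃ M > 0, ∀ z ∈ closedStrip ρ, ‖F z‖ ≤ M := by
  have hK : IsCompact (Set.Icc (0 : ℝ) 1 ×ℂ Set.Icc (-ρ) ρ) := isCompact_Icc.reProdIm isCompact_Icc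
  obtain ⟨M, hM⟩ := hK.exists_bound_of_continuousOn (f := F)
    (hF.analytic.continuousOn.mono fun z hz => abs_le.2 hz.2)
  refine ⟨max M 1, by positivity, fun z hz => ?_⟩
  have h1 := hF.add_int hz (-⌊z.re⌋)
  rw [← h1]
  refine (hM _ ⟨?_, ?_⟩).trans (le_max_left _ _)
  · have h2 := Int.floor_le z.re
    have h3 := Int.lt_floor_add_one z.re
    simp
    constructor <;> linarith
  · simpa using abs_le.1 hz

theorem logMean_comp_add_ofReal (hF : IsStripAnalytic ρ F) {y : ℝ} (hy : |y| ≤ ρ) (a : ℝ) :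
    logMean (fun z => F (z + (a : ℂ))) y = logMean F y := by
  have hp : Function.Periodic
      (fun x : ℝ => Real.log ‖F ((x : ℂ) + (y : ℂ) * Complex.I)‖) 1 := fun x => by
    have := hF.periodic_line hy x
    simp only at this ⊢
    rw [this]
  have h := hp.intervalIntegral_add_eq a 0
  have h2 := intervalIntegral.integral_comp_add_right (a := 0) (b := 1)
    (fun x : ℝ => Real.log ‖F ((x : ℂ) + (y : ℂ) * Complex.I)‖) a
  unfold logMean
  rw [zero_add] at h h2
  rw [← h, add_comm a 1, ← h2]
  refine intervalIntegral.integral_congr fun x _ => ?_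
  simp only
  push_cast
  ring_nf

end IsStripAnalytic

/-! ### Determinant bounds from Gershgorin discs. -/

theorem Matrix.exists_norm_sub_le_of_mem_roots_charpoly {ι : Type*} [Fintype ι] [DecidableEq ι]
    {A : Matrix ι ι ℂ} {μ : ℂ} (hμ : μ ∈ A.charpoly.roots) :
    ∃ p, ‖μ - A p p‖ ≤ ∑ q ∈ Finset.univ.erase p, ‖A p q‖ := by
  have h : Module.End.HasEigenvalue (Matrix.toLin' A) μ := by
    rw [Module.End.hasEigenvalue_iff_isRoot_charpoly, Matrix.charpoly_toLin']
    exact (Polynomial.mem_roots'.1 hμ).2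
  obtain ⟨p, hp⟩ := eigenvalue_mem_ball h
  exact ⟨p, mem_closedBall_iff_norm.1 hp⟩

theorem Matrix.norm_det_eq_prod_norm_roots {ι : Type*} [Fintype ι] [DecidableEq ι]
    (A : Matrix ι ι ℂ) :
    ‖A.det‖ = (A.charpoly.roots.map fun μ => ‖μ‖).prod ∧
      Multiset.card A.charpoly.roots = Fintype.card ι := by
  refine ⟨?_, ?_⟩
  · rw [Matrix.det_eq_prod_roots_charpoly]
    exact map_multiset_prod (normHom : ℂ →*₀ ℝ) _
  · rw [← (IsAlgClosed.splits A.charpoly).natDegree_eq_card_roots,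
      Matrix.charpoly_natDegree_eq_dim]

theorem Multiset.prod_map_le_pow {α : Type*} (s : Multiset α) {f : α → ℝ} {R : ℝ}
    (h0 : ∀ a ∈ s, 0 ≤ f a) (h : ∀ a ∈ s, f a ≤ R) : (s.map f).prod ≤ R ^ Multiset.card s := by
  have := Multiset.prod_map_le_prod_map₀ f (fun _ => R) h0 h
  simpa using this

theorem Multiset.pow_le_prod_map {α : Type*} (s : Multiset α) {f : α → ℝ} {r : ℝ}
    (hr : 0 ≤ r) (h : ∀ a ∈ s, r ≤ f a) : r ^ Multiset.card s ≤ (s.map f).prod := by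
  have := Multiset.prod_map_le_prod_map₀ (fun _ => r) f (fun _ _ => hr) h
  simpa using this

theorem Matrix.norm_det_le_pow {ι : Type*} [Fintype ι] [DecidableEq ι] {A : Matrix ι ι ℂ} {R : ℝ}
    (h : ∀ p, ∑ q, ‖A p q‖ ≤ R) : ‖A.det‖ ≤ R ^ Fintype.card ι := by
  obtain ⟨h1, h2⟩ := A.norm_det_eq_prod_norm_roots
  rw [h1, ← h2]
  refine Multiset.prod_map_le_pow _ (fun _ _ => norm_nonneg _) fun μ hμ => ?_
  obtain ⟨p, hp⟩ := exists_norm_sub_le_of_mem_roots_charpoly hμ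
  have h3 := h p
  rw [← Finset.add_sum_erase _ _ (Finset.mem_univ p)] at h3
  have h4 := norm_add_le (μ - A p p) (A p p)
  rw [sub_add_cancel] at h4
  linarith

/-- By Gershgorin every eigenvalue lies within `τ` of `1`, and the determinant is the product of the
eigenvalues. -/
theorem Matrix.pow_le_norm_det {ι : Type*} [Fintype ι] [DecidableEq ι] {A : Matrix ι ι ℂ} {τ : ℝ}
    (hτ : τ ≤ 1) (h : ∀ p, ∑ q, ‖A p q - (1 : Matrix ι ι ℂ) p q‖ ≤ τ) :
    (1 - τ) ^ Fintype.card ι ≤ ‖A.det‖ := by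
  obtain ⟨h1, h2⟩ := A.norm_det_eq_prod_norm_roots
  rw [h1, ← h2]
  refine Multiset.pow_le_prod_map _ (by linarith) fun μ hμ => ?_
  obtain ⟨p, hp⟩ := exists_norm_sub_le_of_mem_roots_charpoly hμ
  have h3 := h p
  rw [← Finset.add_sum_erase _ _ (Finset.mem_univ p)] at h3
  have h5 : ∑ q ∈ Finset.univ.erase p, ‖A p q - (1 : Matrix ι ι ℂ) p q‖ =
      ∑ q ∈ Finset.univ.erase p, ‖A p q‖ :=
    Finset.sum_congr rfl fun q hq => by
      rw [Matrix.one_apply_ne (Finset.ne_of_mem_erase hq).symm, sub_zero]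
  rw [h5, Matrix.one_apply_eq] at h3
  have h4 : ‖(1 : ℂ)‖ ≤ ‖μ‖ + ‖μ - A p p‖ + ‖A p p - 1‖ := by
    calc ‖(1 : ℂ)‖ = ‖μ - (μ - A p p) - (A p p - 1)‖ := by ring_nf
      _ ≤ _ := (norm_sub_le _ _).trans (by gcongr; exact norm_sub_le _ _)
  rw [norm_one] at h4
  linarith

/-- A perturbation of a diagonal matrix by a matrix with small row sums has determinant comparable
to that of the diagonal matrix. -/
theorem Matrix.prod_mul_pow_le_norm_det_diagonal_add {ι : Type*} [Fintype ι] [DecidableEq ι]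
    (d : ι → ℂ) (hd : ∀ p, d p ≠ 0) (B : Matrix ι ι ℂ) {τ : ℝ} (hτ : τ ≤ 1)
    (h : ∀ p, ∑ q, ‖B p q‖ ≤ τ * ‖d p‖) :
    (∏ p, ‖d p‖) * (1 - τ) ^ Fintype.card ι ≤ ‖(Matrix.diagonal d + B).det‖ := by
  have h1 : Matrix.diagonal d + B =
      Matrix.diagonal d * (1 + Matrix.of fun p q => (d p)⁻¹ * B p q) := by
    rw [Matrix.mul_add, mul_one]
    congr 1
    ext p q
    simp [Matrix.diagonal_mul, hd p]
  rw [h1, Matrix.det_mul, Matrix.det_diagonal, norm_mul, norm_prod]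
  refine mul_le_mul_of_nonneg_left ?_ (Finset.prod_nonneg fun _ _ => norm_nonneg _)
  refine Matrix.pow_le_norm_det hτ fun p => ?_
  simp only [Matrix.add_apply, add_sub_cancel_left, Matrix.of_apply, norm_mul, norm_inv]
  rw [← Finset.mul_sum, inv_mul_le_iff₀ (norm_pos_iff.2 (hd p)), mul_comm]
  exact h p

/-! ### Local lower bounds for `f - E`, uniform in `E`. -/

open Filter Topology in
/-- Near a point where `f - f x₀` vanishes to order `k`, it is the `k`-th power of a function with
nonvanishing derivative. -/
theorem AnalyticAt.exists_eventually_sub_eq_pow {f : ℂ → ℂ} {x₀ : ℂ} (hf : AnalyticAt ℂ f x₀)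
    {k : ℕ} (hk : analyticOrderAt (fun z => f z - f x₀) x₀ = k) :
    ∃ φ : ℂ → ℂ, AnalyticAt ℂ φ x₀ ∧ deriv φ x₀ ≠ 0 ∧
      ∀ᶠ z in 𝓝 x₀, f z - f x₀ = φ z ^ k := by
  have hf' : AnalyticAt ℂ (fun z => f z - f x₀) x₀ := hf.sub analyticAt_const
  have hk0 : k ≠ 0 := by
    rintro rfl
    rw [Nat.cast_zero, hf'.analyticOrderAt_eq_zero] at hk
    exact hk (sub_self _)
  obtain ⟨g, hg, hg0, hfg⟩ := hf'.analyticOrderAt_eq_natCast.1 hk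
  -- A `k`-th root of `g`. Dividing by `g x₀` brings the base of the second power near `1`, inside
  -- the slit plane, where the principal branch is analytic.
  set h : ℂ → ℂ := fun z => g x₀ ^ ((k : ℂ)⁻¹) * (g z / g x₀) ^ ((k : ℂ)⁻¹) with hh
  have hhk : ∀ z, h z ^ k = g z := fun z => by
    rw [hh]
    simp only
    rw [mul_pow, Complex.cpow_nat_inv_pow _ hk0, Complex.cpow_nat_inv_pow _ hk0,
      mul_div_cancel₀ _ hg0]
  have hha : AnalyticAt ℂ h x₀ := by
    refine analyticAt_const.mul (AnalyticAt.cpow (hg.div analyticAt_const hg0) analyticAt_const ?_)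
    rw [div_self hg0]
    exact Complex.one_mem_slitPlane
  have hh0 : h x₀ ≠ 0 := fun h0 => hg0 (by rw [← hhk, h0, zero_pow hk0])
  refine ⟨fun z => (z - x₀) * h z, (analyticAt_id.sub analyticAt_const).mul hha, ?_, ?_⟩
  · have := ((hasDerivAt_id x₀).sub_const x₀).fun_mul hha.differentiableAt.hasDerivAt
    have h2 : deriv (fun z => (z - x₀) * h z) x₀ = h x₀ := by
      refine HasDerivAt.deriv ?_
      simpa using this
    rwa [h2]
  · filter_upwards [hfg] with z hz
    rw [hz, mul_pow, hhk, smul_eq_mul]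

open Filter Topology in
theorem HasStrictDerivAt.exists_mul_norm_sub_le {φ : ℂ → ℂ} {φ' x₀ : ℂ}
    (h : HasStrictDerivAt φ φ' x₀) (h0 : φ' ≠ 0) :
    ∃ a > 0, ∀ᶠ r in 𝓝[>] (0 : ℝ), ∀ z ∈ Metric.closedBall x₀ r, ∀ w ∈ Metric.closedBall x₀ r,
      a * ‖z - w‖ ≤ ‖φ z - φ w‖ := by
  have hpos : 0 < ‖φ'‖ / 2 := by positivity
  refine ⟨‖φ'‖ / 2, hpos, ?_⟩
  have h1 := h.isLittleO.def hpos
  rw [nhds_prod_eq] at h1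
  obtain ⟨r₀, hr₀, hr⟩ := (Metric.nhds_basis_closedBall.prod_self.eventually_iff).1 h1
  filter_upwards [Ioc_mem_nhdsGT hr₀] with r hr' z hz w hw
  have h2 := hr (x := (z, w)) ⟨Metric.closedBall_subset_closedBall hr'.2 hz,
    Metric.closedBall_subset_closedBall hr'.2 hw⟩
  simp only [ContinuousLinearMap.toSpanSingleton_apply, smul_eq_mul] at h2
  have h3 : ‖(z - w) * φ'‖ ≤ ‖φ z - φ w‖ + ‖φ z - φ w - (z - w) * φ'‖ := by
    calc ‖(z - w) * φ'‖ = ‖(φ z - φ w) - (φ z - φ w - (z - w) * φ')‖ := by ring_nf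
      _ ≤ _ := norm_sub_le _ _
  rw [norm_mul] at h3
  linarith

open Filter Topology in
/-- Near a point where `f - f x₀` vanishes to order `k`, every `f - E` is bounded below by a product
of `k` distances, uniformly in `E`. -/
theorem AnalyticAt.exists_mul_prod_norm_sub_le {f : ℂ → ℂ} {x₀ : ℂ} (hf : AnalyticAt ℂ f x₀)
    {k : ℕ} (hk : analyticOrderAt (fun z => f z - f x₀) x₀ = k) :
    ∃ r > 0, ∃ c > 0, ∀ E : ℂ, ∃ s : Multiset ℂ, Multiset.card s = k ∧
      ∀ z ∈ Metric.ball x₀ r, c * (s.map fun w => ‖z - w‖).prod ≤ ‖f z - E‖ := by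
  obtain ⟨φ, hφ, hφ', hfφ⟩ := hf.exists_eventually_sub_eq_pow hk
  have hk0 : 0 < k := by
    refine Nat.pos_of_ne_zero ?_
    rintro rfl
    rw [Nat.cast_zero, AnalyticAt.analyticOrderAt_eq_zero (f := fun z => f z - f x₀)
      (hf.sub analyticAt_const)] at hk
    exact hk (sub_self _)
  obtain ⟨a, ha, har⟩ := hφ.hasStrictDerivAt.exists_mul_norm_sub_le hφ'
  obtain ⟨r₁, hr₁, hr₁U⟩ := Metric.nhds_basis_closedBall.mem_iff.1 
    (Filter.inter_mem hφ.eventually_analyticAt hfφ)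
  obtain ⟨r, hr, hr'⟩ := (har.and (Ioc_mem_nhdsGT hr₁)).exists
  have hrU := (Metric.closedBall_subset_closedBall hr'.2).trans hr₁U
  refine ⟨r, hr'.1, (a / 2) ^ k, by positivity, fun E => ?_⟩
  -- The point `w` minimises `‖φ - ζ‖` on the ball and need not be a zero. By minimality `‖φ z - φ
  -- w‖ ≤ 2 ‖φ z - ζ‖`, so the bound holds for every `ζ`, whether or not `φ` attains it.
  have hW : ∀ ζ : ℂ, ∃ w, ∀ z ∈ Metric.closedBall x₀ r, a / 2 * ‖z - w‖ ≤ ‖φ z - ζ‖ := by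
    intro ζ
    obtain ⟨w, hw, hmin⟩ := (isCompact_closedBall x₀ r).exists_isMinOn
      ⟨x₀, Metric.mem_closedBall_self hr'.1.le⟩
      (f := fun w => ‖φ w - ζ‖) 
      (ContinuousOn.norm (ContinuousOn.sub (fun z hz => (hrU hz).1.continuousAt.continuousWithinAt)
        continuousOn_const))
    refine ⟨w, fun z hz => ?_⟩
    have h1 := hr z hz w hw
    have h2 : ‖φ w - ζ‖ ≤ ‖φ z - ζ‖ := hmin hz
    have h3 : ‖φ z - φ w‖ ≤ ‖φ z - ζ‖ + ‖φ w - ζ‖ := by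
      calc ‖φ z - φ w‖ = ‖(φ z - ζ) - (φ w - ζ)‖ := by ring_nf
        _ ≤ _ := norm_sub_le _ _
    linarith
  choose W hW using hW
  -- Since `f - E = φ ^ k - (E - f x₀)` near `x₀`, it factors as the product of `φ - ζ` over the `k`
  -- roots `ζ` of `p`.
  set p : Polynomial ℂ := Polynomial.X ^ k - Polynomial.C (E - f x₀) with hp
  have hsp : p.Splits := IsAlgClosed.splits p
  have hmon : p.Monic := Polynomial.monic_X_pow_sub_C _ hk0.ne'
  have hcard : Multiset.card p.roots = k := by
    rw [← hsp.natDegree_eq_card_roots, hp, Polynomial.natDegree_X_pow_sub_C]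
  refine ⟨p.roots.map W, by rw [Multiset.card_map, hcard], fun z hz => ?_⟩
  have hz' := Metric.ball_subset_closedBall hz
  have h1 : f z - E = (p.roots.map fun ζ => φ z - ζ).prod := by
    have h2 := hsp.eval_eq_prod_roots_of_monic hmon (φ z)
    rw [← h2]
    have h3 : f z - f x₀ = φ z ^ k := (hrU hz').2
    simp only [hp, Polynomial.eval_sub, Polynomial.eval_pow, Polynomial.eval_X,
      Polynomial.eval_C]
    rw [← h3]
    ring
  have h4 : ‖f z - E‖ = (p.roots.map fun ζ => ‖φ z - ζ‖).prod := by
    have h6 := map_multiset_prod (normHom : ℂ →*₀ ℝ) (p.roots.map fun ζ => φ z - ζ)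
    rw [Multiset.map_map] at h6
    rw [h1]
    exact h6
  rw [h4, Multiset.map_map]
  have h5 := Multiset.prod_map_le_prod_map₀ (s := p.roots) (fun ζ => a / 2 * ‖z - W ζ‖)
    (fun ζ => ‖φ z - ζ‖) (fun ζ _ => by positivity) (fun ζ _ => hW ζ z hz')
  rw [Multiset.prod_map_mul, Multiset.map_const', Multiset.prod_replicate, hcard] at h5
  exact h5

-- If the order exceeded the multiplicity of `z` in `s`, dividing by `‖w - z‖ ^ s.count z` and
-- letting `w → z` would make the right side vanish while the left side stays positive.
open Filter Topology in
theorem AnalyticAt.analyticOrderAt_le_count {f : ℂ → ℂ} {z : ℂ} (hf : AnalyticAt ℂ f z)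
    {s : Multiset ℂ} {c : ℝ} (hc : 0 < c)
    (h : ∀ᶠ w in 𝓝 z, c * (s.map fun a => ‖w - a‖).prod ≤ ‖f w‖) :
    analyticOrderAt f z ≤ (s.count z : ℕ) := by
  by_contra! hlt
  have hle : ((s.count z + 1 : ℕ) : ℕ∞) ≤ analyticOrderAt f z := by
    push_cast
    exact Order.add_one_le_of_lt hlt
  obtain ⟨g, hg, hfg⟩ := (natCast_le_analyticOrderAt hf).1 hle
  set P : ℂ → ℝ := fun w => ((s.filter (· ≠ z)).map fun a => ‖w - a‖).prod with hP
  have hPc : Continuous P := by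
    refine continuous_multiset_prod _ fun a _ => by fun_prop
  have hPpos : 0 < P z := by
    refine Multiset.prod_pos fun x hx => ?_
    obtain ⟨a, ha, rfl⟩ := Multiset.mem_map.1 hx
    exact norm_pos_iff.2 (sub_ne_zero.2 (Multiset.mem_filter.1 ha).2.symm)
  have hsplit : ∀ w, (s.map fun a => ‖w - a‖).prod = ‖w - z‖ ^ s.count z * P w := by
    intro w
    conv_lhs => rw [← Multiset.filter_add_not (· = z) s]
    rw [Multiset.map_add, Multiset.prod_add, Multiset.filter_eq', Multiset.map_replicate,
      Multiset.prod_replicate]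
  have hev : ∀ᶠ w in 𝓝[≠] z, c * P w ≤ ‖w - z‖ * ‖g w‖ := by
    filter_upwards [h.filter_mono nhdsWithin_le_nhds, hfg.filter_mono nhdsWithin_le_nhds,
      self_mem_nhdsWithin] with w h1 h2 h3
    have hpos : 0 < ‖w - z‖ := norm_pos_iff.2 (sub_ne_zero.2 h3)
    rw [hsplit, h2, norm_smul, norm_pow, pow_succ] at h1
    have h4 : 0 < ‖w - z‖ ^ s.count z := by positivity
    refine le_of_mul_le_mul_left ?_ h4
    calc _ = c * (‖w - z‖ ^ s.count z * P w) := by ring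
      _ ≤ _ := h1
      _ = _ := by ring
  have hl1 : Tendsto (fun w => c * P w) (𝓝[≠] z) (𝓝 (c * P z)) :=
    ((continuous_const.mul hPc).tendsto z).mono_left nhdsWithin_le_nhds
  have hl2 : Tendsto (fun w => ‖w - z‖ * ‖g w‖) (𝓝[≠] z) (𝓝 (‖z - z‖ * ‖g z‖)) := by
    have : ContinuousAt (fun w => ‖w - z‖ * ‖g w‖) z := by
      have := hg.continuousAt
      fun_prop
    exact this.tendsto.mono_left nhdsWithin_le_nhds
  have := le_of_tendsto_of_tendsto hl1 hl2 hev
  rw [sub_self, norm_zero, zero_mul] at this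
  exact absurd this (not_le.2 (mul_pos hc hPpos))

/-! ### Zero counts and lower bounds on horizontal lines. -/

namespace IsPotential

variable {ρ : ℝ} {f : ℂ → ℂ}

theorem analyticOrderAt_ne_top (hf : IsPotential ρ f) (hρ : 0 ≤ ρ) {z₀ : ℂ}
    (hz₀ : z₀ ∈ closedStrip ρ) (E : ℂ) : analyticOrderAt (fun z => f z - E) z₀ ≠ ⊤ := by
  intro h
  rw [analyticOrderAt_eq_top] at h
  have h1 := (hf.isStripAnalytic.sub_const E).analytic.eqOn_zero_of_preconnected_of_eventuallyEq_zero
    (isPreconnected_closedStrip ρ) hz₀ h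
  obtain ⟨x, y, hxy⟩ := hf.nonconstant
  have hx := h1 (show (x : ℂ) ∈ closedStrip ρ by simpa [mem_closedStrip] using hρ)
  have hy := h1 (show (y : ℂ) ∈ closedStrip ρ by simpa [mem_closedStrip] using hρ)
  simp only [Pi.zero_apply, sub_eq_zero] at hx hy
  exact hxy (hx.trans hy.symm)

/-- The bound of `AnalyticAt.exists_mul_prod_norm_sub_le` at a point of the closed strip. -/
theorem exists_local_bound (hf : IsPotential ρ f) (hρ : 0 ≤ ρ) {z₀ : ℂ}
    (hz₀ : z₀ ∈ closedStrip ρ) :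
    ∃ r > 0, ∃ c > 0, ∀ E : ℂ, ∃ s : Multiset ℂ,
      (Multiset.card s : ℕ∞) = analyticOrderAt (fun z => f z - f z₀) z₀ ∧
      ∀ z ∈ Metric.ball z₀ r, c * (s.map fun w => ‖z - w‖).prod ≤ ‖f z - E‖ := by
  obtain ⟨k, hk⟩ := ENat.ne_top_iff_exists.1 (hf.analyticOrderAt_ne_top hρ hz₀ (f z₀))
  obtain ⟨r, hr, c, hc, h⟩ := (hf.analytic z₀ hz₀).exists_mul_prod_norm_sub_le hk.symm
  refine ⟨r, hr, c, hc, fun E => ?_⟩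
  obtain ⟨s, hs, hs'⟩ := h E
  exact ⟨s, by rw [hs, hk], hs'⟩

/-- Finitely many local bounds cover a period, and the number of factors in each is independent of
`E`. Each zero of `f - E` must occur among these factors with at least its multiplicity. -/
theorem exists_zeroCount_le (hf : IsPotential ρ f) (hρ : 0 ≤ ρ) :
    ∃ K : ℕ, ∀ E : ℝ, zeroCount ρ f E ≤ K := by
  have hK : IsCompact (Set.Icc (0 : ℝ) 1 ×ℂ Set.Icc (-ρ) ρ) := isCompact_Icc.reProdIm isCompact_Icc
  have hsub : ∀ z ∈ Set.Icc (0 : ℝ) 1 ×ℂ Set.Icc (-ρ) ρ, z ∈ closedStrip ρ := fun z hz =>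
    abs_le.2 hz.2
  have hloc := fun z : (Set.Icc (0 : ℝ) 1 ×ℂ Set.Icc (-ρ) ρ) =>
    hf.exists_local_bound hρ (hsub z z.2)
  choose r hr c hc S hS hSb using hloc
  obtain ⟨t, ht⟩ := hK.elim_finite_subcover (fun z => Metric.ball z.1 (r z))
    (fun z => Metric.isOpen_ball)
    (fun z hz => Set.mem_iUnion.2 ⟨⟨z, hz⟩, Metric.mem_ball_self (hr _)⟩)
  refine ⟨∑ z₀ ∈ t, (analyticOrderAt (fun z => f z - f z₀) z₀.1).toNat, fun E => ?_⟩
  refine iSup₂_le fun s hs => ?_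
  have hord : ∀ z ∈ s, analyticOrderAt (fun w => f w - (E : ℂ)) z ≤
      ((∑ z₀ ∈ t, (S z₀ E).count z : ℕ) : ℕ∞) := by
    intro z hz
    have hz' : z ∈ Set.Icc (0 : ℝ) 1 ×ℂ Set.Icc (-ρ) ρ :=
      ⟨⟨(hs hz).1, (hs hz).2.1.le⟩, abs_le.1 (hs hz).2.2⟩
    obtain ⟨z₀, hz₀, hzz⟩ := Set.mem_iUnion₂.1 (ht hz')
    refine (AnalyticAt.analyticOrderAt_le_count
      ((hf.isStripAnalytic.sub_const E).analytic z (hsub z hz')) (hc z₀) (s := S z₀ E) ?_).trans ?_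
    · filter_upwards [Metric.isOpen_ball.mem_nhds hzz] with w hw using hSb z₀ E w hw
    · exact_mod_cast Finset.single_le_sum (f := fun z₀ => (S z₀ E).count z)
        (fun _ _ => Nat.zero_le _) hz₀
  refine (Finset.sum_le_sum hord).trans ?_
  rw [← Nat.cast_sum, Finset.sum_comm]
  refine Nat.cast_le.2 (Finset.sum_le_sum fun z₀ _ => ?_)
  rw [← hS z₀ E, ENat.toNat_natCast]
  calc ∑ z ∈ s, (S z₀ E).count z = Multiset.card ((S z₀ E).filter (· ∈ s)) := by
        rw [← Multiset.sum_count_eq_card (s := s) (m := (S z₀ E).filter (· ∈ s))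
          (fun a ha => (Multiset.mem_filter.1 ha).2)]
        exact Finset.sum_congr rfl fun z hz => (Multiset.count_filter_of_pos hz).symm
    _ ≤ _ := Multiset.card_le_card (Multiset.filter_le _ _)

theorem analyticOrderAt_le_zeroCount (hρ : 0 ≤ ρ) {x : ℝ} (hx : x ∈ Set.Ico (0 : ℝ) 1) (E : ℝ) :
    analyticOrderAt (fun z => f z - (E : ℂ)) (x : ℂ) ≤ zeroCount ρ f E := by
  have h : (({(x : ℂ)} : Finset ℂ) : Set ℂ) ⊆ periodStrip ρ := by
    simpa [periodStrip, hρ] using hx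
  refine le_trans ?_ (le_iSup₂_of_le (i := {(x : ℂ)}) (j := h) le_rfl)
  simp

theorem ofReal_re (hf : IsPotential ρ f) (x : ℝ) : (((f x).re : ℝ) : ℂ) = f x :=
  Complex.ext (by simp) (by simp [hf.real x])

theorem one_le_zeroCount (hf : IsPotential ρ f) (hρ : 0 ≤ ρ) :
    1 ≤ zeroCount ρ f (f (0 : ℝ)).re := by
  refine le_trans ?_ (analyticOrderAt_le_zeroCount hρ (x := 0) (by simp) _)
  rw [Order.one_le_iff_ne_zero, AnalyticAt.analyticOrderAt_ne_zero]
  · rw [hf.ofReal_re, sub_self]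
  · exact (hf.isStripAnalytic.sub_const _).analytic _ (by simpa [mem_closedStrip] using hρ)

/-- On lines close to the real axis `f - E` is bounded below by a power of the distance of the
height of the line to finitely many heights. -/
theorem exists_line_bound (hf : IsPotential ρ f) (hρ : 0 < ρ) {S : ℕ}
    (hS : ∀ E : ℝ, zeroCount ρ f E ≤ S) :
    ∃ δ₀ > 0, ∃ c > 0, ∃ A : ℕ, ∀ E : ℂ, ∃ s : Finset ℝ, s.card ≤ A ∧
      ∀ x y η : ℝ, |y| < δ₀ → 0 ≤ η → η ≤ 1 → (∀ p ∈ s, η ≤ |y - p|) →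
        c * η ^ S ≤ ‖f ((x : ℂ) + (y : ℂ) * Complex.I) - E‖ := by
  have hmem : ∀ x : ℝ, (x : ℂ) ∈ closedStrip ρ := fun x => by
    simpa [mem_closedStrip] using hρ.le
  have hloc := fun x : ℝ => hf.exists_local_bound hρ.le (hmem (Int.fract x))
  choose r hr c hc T hT hTb using hloc
  -- The centres are real, so `f` takes a real value there and the local order is counted by
  -- `zeroCount` at that real energy. This is why the exponent is `S`, whatever the number of balls.
  -- The fractional part puts the centre in the half-open period.
  have hTS : ∀ x E, Multiset.card (T x E) ≤ S := by
    intro x E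
    have h1 := hT x E
    rw [← hf.ofReal_re] at h1
    have h2 := (analyticOrderAt_le_zeroCount hρ.le
      ⟨Int.fract_nonneg x, Int.fract_lt_one x⟩ _).trans (hS (f (Int.fract x : ℝ)).re)
    rw [← h1] at h2
    exact_mod_cast h2
  have hK : IsCompact (Complex.ofReal '' Set.Icc 0 1) :=
    isCompact_Icc.image Complex.continuous_ofReal
  obtain ⟨t, ht⟩ := hK.elim_finite_subcover (fun x : ℝ => Metric.ball (x : ℂ) (r x))
    (fun z => Metric.isOpen_ball) (by
      rintro _ ⟨x, hx, rfl⟩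
      exact Set.mem_iUnion.2 ⟨x, Metric.mem_ball_self (hr _)⟩)
  obtain ⟨δ, hδ, hδt⟩ := hK.exists_thickening_subset_open
    (isOpen_biUnion fun x _ => Metric.isOpen_ball) ht
  have htne : t.Nonempty := by
    obtain ⟨x, hx, -⟩ := Set.mem_iUnion₂.1 (ht ⟨0, by simp, rfl⟩)
    exact ⟨x, hx⟩
  refine ⟨min δ ρ, lt_min hδ hρ, t.inf' htne c, (Finset.lt_inf'_iff _).2 fun x _ => hc x,
    t.card * S, fun E => ?_⟩
  refine ⟨t.biUnion fun x => ((T x E).map Complex.im).toFinset, ?_, ?_⟩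
  · refine Finset.card_biUnion_le_card_mul _ _ _ fun x _ => ?_
    refine (Multiset.toFinset_card_le _).trans ?_
    rw [Multiset.card_map]
    exact hTS x E
  · intro x y η hy hη0 hη1 hη
    have hyδ := hy.trans_le (min_le_left _ _)
    have hyρ := hy.trans_le (min_le_right _ _)
    have hz : ((Int.fract x : ℝ) : ℂ) + (y : ℂ) * Complex.I ∈
        Metric.thickening δ (Complex.ofReal '' Set.Icc 0 1) := by
      refine Metric.mem_thickening_iff.2 ⟨_, ⟨Int.fract x, ⟨Int.fract_nonneg x,
        (Int.fract_lt_one x).le⟩, rfl⟩, ?_⟩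
      simpa [dist_eq_norm] using hyδ
    obtain ⟨x₀, hx₀, hzx⟩ := Set.mem_iUnion₂.1 (hδt hz)
    set z : ℂ := ((Int.fract x : ℝ) : ℂ) + (y : ℂ) * Complex.I with hzdef
    have hfz : f ((x : ℂ) + (y : ℂ) * Complex.I) = f (z - (⌊x₀⌋ : ℤ)) := by
      -- Two shifts: `⌊x⌋` brings the point over `[0, 1)`, and `⌊x₀⌋` moves the covering ball at
      -- `x₀` to the ball at `Int.fract x₀`, where the local bound holds.
      have h1 := hf.isStripAnalytic.add_int (line_mem_closedStrip hyρ.le x) (-⌊x⌋ - ⌊x₀⌋)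
      rw [← h1, hzdef, Int.fract]
      push_cast
      ring_nf
    have hball : z - (⌊x₀⌋ : ℤ) ∈ Metric.ball ((Int.fract x₀ : ℝ) : ℂ) (r x₀) := by
      rw [Metric.mem_ball, dist_eq_norm] at hzx ⊢
      convert hzx using 2
      rw [Int.fract]
      push_cast
      ring
    have h1 := hTb x₀ E _ hball
    rw [hfz]
    refine le_trans ?_ h1
    have h2 : η ^ Multiset.card (T x₀ E) ≤
        ((T x₀ E).map fun w => ‖z - (⌊x₀⌋ : ℤ) - w‖).prod := by
      refine Multiset.pow_le_prod_map _ hη0 fun w hw => ?_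
      have h3 := hη w.im (Finset.mem_biUnion.2 ⟨x₀, hx₀, by
        rw [Multiset.mem_toFinset]
        exact Multiset.mem_map_of_mem _ hw⟩)
      refine h3.trans (le_trans (le_of_eq ?_) (Complex.abs_im_le_norm _))
      simp [hzdef]
    exact mul_le_mul (Finset.inf'_le _ hx₀)
      ((pow_le_pow_of_le_one hη0 hη1 (hTS x₀ E)).trans h2) (by positivity) (hc x₀).le

end IsPotential

/-! ### Finiteness of the total count, and heights good for all potentials at once. -/

theorem zeroBound_ne_top {l : ℕ} {ρ : ℝ} (hρ : 0 ≤ ρ) {v : Fin l → ℂ → ℂ}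
    (hv : ∀ j, IsPotential ρ (v j)) : zeroBound ρ v ≠ ⊤ := by
  choose K hK using fun j => (hv j).exists_zeroCount_le hρ
  have h : zeroBound ρ v ≤ ((∑ j, K j : ℕ) : ℕ∞) := by
    rw [Nat.cast_sum]
    exact Finset.sum_le_sum fun j _ => iSup_le (hK j)
  exact ne_top_of_le_ne_top (ENat.natCast_ne_top _) h

theorem zeroCount_le_zeroBound {l : ℕ} {ρ : ℝ} (v : Fin l → ℂ → ℂ) (j : Fin l) (E : ℝ) :
    zeroCount ρ (v j) E ≤ zeroBound ρ v :=
  (le_iSup (fun E : ℝ => zeroCount ρ (v j) E) E).trans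
    (Finset.single_le_sum (f := fun j => ⨆ E : ℝ, zeroCount ρ (v j) E)
      (fun _ _ => zero_le) (Finset.mem_univ j))

theorem exists_pos_forall_le {ι : Type*} [Fintype ι] {a : ι → ℝ} (ha : ∀ i, 0 < a i) :
    ∃ e > 0, ∀ i, e ≤ a i := by
  cases isEmpty_or_nonempty ι
  · exact ⟨1, one_pos, fun i => isEmptyElim i⟩
  · exact ⟨Finset.univ.inf' Finset.univ_nonempty a, (Finset.lt_inf'_iff _).2 fun i _ => ha i,
      fun i => Finset.inf'_le _ (Finset.mem_univ i)⟩

/-- A point of `(0, δ)` at distance at least `δ / (2 (A + 1))` from `A` given points. -/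
theorem exists_forall_le_abs_sub (s : Finset ℝ) {A : ℕ} (hs : s.card ≤ A) {δ : ℝ} (hδ : 0 < δ) :
    ∃ y ∈ Set.Ioo 0 δ, ∀ p ∈ s, δ / (2 * (A + 1)) ≤ |y - p| := by
  set h : ℝ := δ / (2 * (A + 1)) with hh
  have hA : (0 : ℝ) < A + 1 := by positivity
  have hpos : 0 < h := by positivity
  have hδh : δ = h * (2 * (A + 1)) := by rw [hh]; field_simp
  by_contra! hcon
  -- The `A + 1` odd multiples of `h` are spaced by at least `2 h`, so one point of `s` cannot be
  -- closer than `h` to two of them; the pigeonhole principle concludes.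
  have hy : ∀ i ∈ Finset.range (A + 1), (2 * (i : ℝ) + 1) * h ∈ Set.Ioo 0 δ := by
    intro i hi
    have h1 : (i : ℝ) + 1 ≤ A + 1 := by exact_mod_cast Finset.mem_range.1 hi
    refine ⟨by positivity, ?_⟩
    rw [hδh, mul_comm]
    exact mul_lt_mul_of_pos_left (by linarith) hpos
  choose! g hgs hg using fun i hi => hcon _ (hy i hi)
  obtain ⟨i, hi, j, hj, hij, hgij⟩ := Finset.exists_ne_map_eq_of_card_lt_of_maps_to
    (s := Finset.range (A + 1)) (t := s) (by rw [Finset.card_range]; omega) (f := g)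
    (fun i hi => hgs i hi)
  have h1 := abs_lt.1 (hg i hi)
  have h2 := abs_lt.1 (hg j hj)
  rw [hgij] at h1
  rcases lt_or_gt_of_ne hij with hlt | hlt
  · have h3 : (i : ℝ) + 1 ≤ j := by exact_mod_cast hlt
    nlinarith
  · have h3 : (j : ℝ) + 1 ≤ i := by exact_mod_cast hlt
    nlinarith

/-- For every `E` there are lines arbitrarily close to the real axis on which all the `v j - E` are
bounded below by a power of the distance to the axis. -/
theorem exists_good_line {l : ℕ} {ρ : ℝ} (hρ : 0 < ρ) {v : Fin l → ℂ → ℂ}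
    (hv : ∀ j, IsPotential ρ (v j)) {S : ℕ} (hS : (S : ℕ∞) = zeroBound ρ v) :
    ∃ δ₀ > 0, δ₀ ≤ ρ ∧ ∃ c > 0, ∀ E δ : ℝ, 0 < δ → δ ≤ δ₀ → ∃ y ∈ Set.Ioo 0 δ,
      ∀ (x : ℝ) (j : Fin l),
        c * δ ^ S * (1 + |E|) ≤ ‖v j ((x : ℂ) + (y : ℂ) * Complex.I) - E‖ := by
  have hline := fun j => (hv j).exists_line_bound hρ (S := S)
    (fun E => (zeroCount_le_zeroBound v j E).trans hS.symm.le)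
  choose d hd c hc A hA using hline
  choose M hM hMb using fun j => (hv j).isStripAnalytic.exists_norm_le
  obtain ⟨d₀, hd₀, hd₀'⟩ : ∃ d₀ > 0, ∀ j, d₀ ≤ d j := exists_pos_forall_le hd
  obtain ⟨c₀, hc₀, hc₀'⟩ : ∃ c₀ > 0, ∀ j, c₀ ≤ c j := exists_pos_forall_le hc
  set m : ℝ := ∑ j, M j with hm
  have hmj : ∀ j, M j ≤ m := fun j => Finset.single_le_sum (fun i _ => (hM i).le) (Finset.mem_univ j)
  have hm0 : 0 ≤ m := Finset.sum_nonneg fun j _ => (hM j).le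
  set B : ℕ := ∑ j, A j with hB
  set κ : ℝ := (1 / (2 * ((B : ℝ) + 1))) with hκ
  have hκ0 : 0 < κ := by positivity
  have hκ1 : κ ≤ 1 := by
    rw [hκ, div_le_one (by positivity)]
    have : (0 : ℝ) ≤ B := by positivity
    linarith
  refine ⟨min (min d₀ ρ) 1, by positivity, (min_le_left _ _).trans (min_le_right _ _),
    -- The first constant serves `|E| ≤ 2 m + 1`, where `1 + |E|` is bounded and the zeros matter.
    -- The second serves larger `|E|`, where `|v j - E| ≥ |E| - m` suffices.
    min (c₀ * κ ^ S / (2 * m + 3)) (1 / (2 * m + 3)), by positivity, fun E δ hδ hδ₀ => ?_⟩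
  choose s hsc hs using fun j => hA j (E : ℂ)
  obtain ⟨y, hy, hys⟩ := exists_forall_le_abs_sub (Finset.univ.biUnion s) (A := B)
    (Finset.card_biUnion_le.trans (Finset.sum_le_sum fun j _ => hsc j)) hδ
  have hδ1 : δ ≤ 1 := hδ₀.trans (min_le_right _ _)
  have hyδ : |y| < min d₀ ρ := by
    rw [abs_of_pos hy.1]
    exact hy.2.trans_le (hδ₀.trans (min_le_left _ _))
  refine ⟨y, hy, fun x j => ?_⟩
  have hE := abs_nonneg E
  rcases le_or_gt |E| (2 * m + 1) with hEm | hEm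
  · have hη : δ / (2 * ((B : ℝ) + 1)) = κ * δ := by rw [hκ]; ring
    have h1 := hs j x y (κ * δ) ((hyδ.trans_le (min_le_left _ _)).trans_le (hd₀' j)) (by positivity)
      (mul_le_one₀ hκ1 hδ.le hδ1) (fun p hp => by
        rw [← hη]
        exact hys p (Finset.mem_biUnion.2 ⟨j, Finset.mem_univ j, hp⟩))
    refine le_trans ?_ h1
    calc _ ≤ c₀ * κ ^ S / (2 * m + 3) * δ ^ S * (2 * m + 3) := by
          refine mul_le_mul (mul_le_mul_of_nonneg_right (min_le_left _ _) (by positivity))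
            (by linarith) (by positivity) (by positivity)
      _ = c₀ * (κ * δ) ^ S := by
          rw [mul_pow]
          field_simp
      _ ≤ _ := by gcongr; exact hc₀' j
  · have h1 : ‖v j ((x : ℂ) + (y : ℂ) * Complex.I)‖ ≤ m :=
      (hMb j _ (line_mem_closedStrip (hyδ.le.trans (min_le_right _ _)) x)).trans (hmj j)
    have h2 : |E| - m ≤ ‖v j ((x : ℂ) + (y : ℂ) * Complex.I) - E‖ := by
      have h3 := norm_sub_norm_le (E : ℂ) (v j ((x : ℂ) + (y : ℂ) * Complex.I))
      rw [norm_sub_rev, Complex.norm_real, Real.norm_eq_abs] at h3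
      linarith
    refine le_trans ?_ h2
    calc _ ≤ 1 / (2 * m + 3) * 1 * (1 + |E|) := by
          gcongr
          · exact min_le_right _ _
          · exact pow_le_one₀ hδ.le hδ1
      _ ≤ _ := by
          rw [mul_one, one_div, inv_mul_le_iff₀ (by positivity)]
          nlinarith

/-! ### Convexity of the logarithmic mean in the height. -/

theorem Function.Periodic.uniformContinuous_of_continuous {h : ℝ → ℝ} (hp : Function.Periodic h 1)
    (hc : Continuous h) : UniformContinuous h := by
  have huc := (isCompact_Icc (a := (-1 : ℝ)) (b := 2)).uniformContinuousOn_of_continuous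
    hc.continuousOn
  refine Metric.uniformContinuous_iff.2 fun ε hε => ?_
  obtain ⟨δ, hδ, hδh⟩ := Metric.uniformContinuousOn_iff.1 huc ε hε
  refine ⟨min δ 1, by positivity, fun {a b} hab => ?_⟩
  have h1 : ∀ x, h (x - ⌊a⌋) = h x := fun x => by
    have := hp.sub_zsmul_eq (x := x) ⌊a⌋
    rwa [zsmul_one] at this
  have h2 := Int.floor_le a
  have h3 := Int.lt_floor_add_one a
  have h4 := hab.trans_le (min_le_right _ _)
  rw [Real.dist_eq, abs_lt] at h4
  rw [← h1 a, ← h1 b]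
  refine hδh _ ⟨by linarith, by linarith⟩ _ ⟨by linarith, by linarith⟩ ?_
  rw [dist_sub_right]
  exact hab.trans_le (min_le_left _ _)

/-- Uniform continuity makes the Riemann sums converge uniformly in the base point `x`; this gives a
supremum bound on a whole line, as the three lines theorem requires. -/
theorem Function.Periodic.exists_riemann_sum_le {h : ℝ → ℝ} (hp : Function.Periodic h 1)
    (hc : Continuous h) {ε : ℝ} (hε : 0 < ε) :
    ∃ q₀ : ℕ, ∀ q : ℕ, q₀ ≤ q → ∀ x : ℝ,
      ∑ k ∈ Finset.range q, h (x + (k : ℝ) / q) ≤ q * ((∫ s in (0 : ℝ)..1, h s) + ε) := by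
  have huc : UniformContinuous h := hp.uniformContinuous_of_continuous hc
  obtain ⟨δ, hδ, hδh⟩ := Metric.uniformContinuous_iff.1 huc ε hε
  obtain ⟨q₀, hq₀⟩ := exists_nat_gt (1 / δ)
  refine ⟨q₀, fun q hq x => ?_⟩
  have hq1 : 1 / δ < q := hq₀.trans_le (by exact_mod_cast hq)
  have hq0 : (0 : ℝ) < q := lt_trans (by positivity) hq1
  have hqδ : 1 / (q : ℝ) < δ := by rwa [one_div_lt hq0 hδ]
  have hstep : ∀ k : ℕ, x + ((k + 1 : ℕ) : ℝ) / q = x + (k : ℝ) / q + 1 / q := fun k => by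
    push_cast
    ring
  have hk : ∀ k ∈ Finset.range q, h (x + (k : ℝ) / q) * (1 / q) ≤
      (∫ s in (x + (k : ℝ) / q)..(x + ((k + 1 : ℕ) : ℝ) / q), h s) + ε * (1 / q) := by
    intro k _
    have h1 : (∫ s in (x + (k : ℝ) / q)..(x + ((k + 1 : ℕ) : ℝ) / q), (h (x + (k : ℝ) / q) - ε)) ≤
        ∫ s in (x + (k : ℝ) / q)..(x + ((k + 1 : ℕ) : ℝ) / q), h s := by
      refine intervalIntegral.integral_mono_on (by rw [hstep]; linarith [one_div_pos.2 hq0])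
        intervalIntegrable_const (hc.intervalIntegrable _ _) fun s hs => ?_
      rw [hstep] at hs
      have h2 := hδh (a := x + (k : ℝ) / q) (b := s) (by
        rw [Real.dist_eq, abs_lt]
        constructor <;> linarith [hs.1, hs.2])
      rw [Real.dist_eq, abs_lt] at h2
      linarith [h2.2]
    rw [intervalIntegral.integral_const, hstep, smul_eq_mul] at h1
    rw [hstep]
    nlinarith
  have hsum := Finset.sum_le_sum hk
  rw [← Finset.sum_mul, Finset.sum_add_distrib,
    intervalIntegral.sum_integral_adjacent_intervals (a := fun k : ℕ => x + (k : ℝ) / q)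
      (fun k _ => hc.intervalIntegrable _ _)] at hsum
  have hper := hp.intervalIntegral_add_eq x 0
  rw [zero_add] at hper
  simp only [Nat.cast_zero, zero_div, add_zero, div_self hq0.ne', hper, Finset.sum_const,
    Finset.card_range, nsmul_eq_mul] at hsum
  have h5 : (q : ℝ) * (ε * (1 / q)) = ε := by field_simp
  rw [h5, mul_one_div, div_le_iff₀ hq0] at hsum
  linarith

namespace IsStripAnalytic

variable {ρ : ℝ} {F : ℂ → ℂ}

/-- Hadamard's three lines theorem on a horizontal strip. -/
theorem norm_le_of_three_lines (hF : IsStripAnalytic ρ F) {a c θ A C : ℝ} (ha : |a| ≤ ρ)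
    (hc : |c| ≤ ρ) (hac : a < c) (hθ : θ ∈ Set.Icc (0 : ℝ) 1)
    (hA : ∀ x : ℝ, ‖F ((x : ℂ) + (a : ℂ) * Complex.I)‖ ≤ A)
    (hC : ∀ x : ℝ, ‖F ((x : ℂ) + (c : ℂ) * Complex.I)‖ ≤ C) (x : ℝ) :
    ‖F ((x : ℂ) + (((1 - θ) * a + θ * c : ℝ) : ℂ) * Complex.I)‖ ≤ A ^ (1 - θ) * C ^ θ := by
  -- Multiplication by `i` turns the vertical strip `0 ≤ Re w ≤ 1` into the horizontal strip between
  -- heights `a` and `c`.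
  set m : ℂ → ℂ := fun w => Complex.I * (a + (c - a) * w) with hm
  have hac' : c - a ≠ 0 := by linarith
  have him : ∀ w, (m w).im = a + (c - a) * w.re := fun w => by simp [hm]
  have hre : ∀ w, (m w).re = -((c - a) * w.im) := fun w => by simp [hm]
  have hmap : ∀ w ∈ Complex.HadamardThreeLines.verticalClosedStrip 0 1, m w ∈ closedStrip ρ := by
    intro w hw
    rw [mem_closedStrip, him]
    have h1 : 0 ≤ w.re := hw.1
    have h2 : w.re ≤ 1 := hw.2
    rw [abs_le] at ha hc ⊢
    constructor <;> nlinarith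
  have hdiff : DiffContOnCl ℂ (fun w => F (m w))
      (Complex.HadamardThreeLines.verticalStrip 0 1) := by
    refine DifferentiableOn.diffContOnCl fun w hw => ?_
    have hw' : w ∈ Complex.HadamardThreeLines.verticalClosedStrip 0 1 := by
      rw [Complex.HadamardThreeLines.verticalStrip, Complex.closure_preimage_re,
        closure_Ioo zero_ne_one] at hw
      exact hw
    refine (DifferentiableAt.comp w (hF.analytic _ (hmap w hw')).differentiableAt ?_)
      |>.differentiableWithinAt
    fun_prop
  obtain ⟨M, -, hM⟩ := hF.exists_norm_le
  have hbdd : BddAbove ((norm ∘ fun w => F (m w)) ''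
      Complex.HadamardThreeLines.verticalClosedStrip 0 1) := by
    refine ⟨M, ?_⟩
    rintro _ ⟨w, hw, rfl⟩
    exact hM _ (hmap w hw)
  have hline : ∀ (w : ℂ) (y : ℝ), a + (c - a) * w.re = y →
      m w = ((-((c - a) * w.im) : ℝ) : ℂ) + (y : ℂ) * Complex.I := fun w y h =>
    Complex.ext (by rw [hre]; simp) (by rw [him, h]; simp)
  set w : ℂ := ⟨θ, -(x / (c - a))⟩ with hw
  have hmw : m w = (x : ℂ) + (((1 - θ) * a + θ * c : ℝ) : ℂ) * Complex.I := by
    rw [hline w _ (show a + (c - a) * w.re = (1 - θ) * a + θ * c by rw [hw]; ring)]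
    congr 2
    rw [hw]
    field_simp
  have h := Complex.HadamardThreeLines.norm_le_interp_of_mem_verticalClosedStrip₀₁'
    (fun w => F (m w)) (z := w) (a := A) (b := C) hθ hdiff hbdd
    (fun w hw => by
      rw [hline w a (by rw [show w.re = 0 from hw]; ring)]
      exact hA _)
    (fun w hw => by
      rw [hline w c (by rw [show w.re = 1 from hw]; ring)]
      exact hC _)
  rw [hmw] at h
  exact h

theorem logMean_le_log (hF : IsStripAnalytic ρ F) (h0 : ∃ z ∈ closedStrip ρ, F z ≠ 0) {y B : ℝ}
    (hy : |y| ≤ ρ) (hB : ∀ x : ℝ, ‖F ((x : ℂ) + (y : ℂ) * Complex.I)‖ ≤ B) :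
    logMean F y ≤ Real.log B := by
  have h1 : logMean F y ≤ ∫ _ in (0 : ℝ)..1, Real.log B := by
    refine intervalIntegral.integral_mono_ae zero_le_one (hF.intervalIntegrable_log hy 0 1)
      intervalIntegrable_const ?_
    filter_upwards [hF.ae_ne_zero h0 hy] with x hx
    exact Real.log_le_log (norm_pos_iff.2 hx) (hB x)
  simpa using h1

theorem exists_prod_ne_zero {ι : Type*} (s : Finset ι) {G : ι → ℂ → ℂ} (hρ : 0 ≤ ρ)
    (hG : ∀ i ∈ s, IsStripAnalytic ρ (G i)) (h0 : ∀ i ∈ s, ∃ z ∈ closedStrip ρ, G i z ≠ 0) :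
    ∃ z ∈ closedStrip ρ, ∏ i ∈ s, G i z ≠ 0 := by
  have hall : ∀ᵐ x : ℝ, ∀ i ∈ s, G i ((x : ℂ) + ((0 : ℝ) : ℂ) * Complex.I) ≠ 0 :=
    (Filter.eventually_all_finset s).2 fun i hi => (hG i hi).ae_ne_zero (h0 i hi) (by simpa using hρ)
  obtain ⟨x, hx⟩ := hall.exists
  exact ⟨_, line_mem_closedStrip (by simpa using hρ) x, Finset.prod_ne_zero_iff.2 hx⟩

theorem logMean_prod {ι : Type*} (s : Finset ι) {G : ι → ℂ → ℂ}
    (hG : ∀ i ∈ s, IsStripAnalytic ρ (G i)) (h0 : ∀ i ∈ s, ∃ z ∈ closedStrip ρ, G i z ≠ 0) {y : ℝ}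
    (hy : |y| ≤ ρ) : logMean (fun z => ∏ i ∈ s, G i z) y = ∑ i ∈ s, logMean (G i) y := by
  unfold logMean
  rw [← intervalIntegral.integral_finsetSum fun i hi => (hG i hi).intervalIntegrable_log hy 0 1]
  refine intervalIntegral.integral_congr_ae ?_
  filter_upwards [(Filter.eventually_all_finset s).2 fun i hi =>
    (hG i hi).ae_ne_zero (h0 i hi) hy] with x hx _
  rw [norm_prod, Real.log_prod fun i hi => norm_ne_zero_iff.2 (hx i hi)]

-- For `η ≤ 1` truncation only decreases `|log|`, so `|log |F||` itself dominates.
open Filter Topology in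
theorem tendsto_integral_log_max (hF : IsStripAnalytic ρ F)
    (h0 : ∃ z ∈ closedStrip ρ, F z ≠ 0) {y : ℝ} (hy : |y| ≤ ρ) :
    Tendsto (fun η : ℝ => ∫ x in (0 : ℝ)..1,
      Real.log (max ‖F ((x : ℂ) + (y : ℂ) * Complex.I)‖ η)) (𝓝[>] 0) (𝓝 (logMean F y)) := by
  have hc := (hF.continuous_line hy).norm
  refine intervalIntegral.tendsto_integral_filter_of_dominated_convergence
    (fun x => |Real.log ‖F ((x : ℂ) + (y : ℂ) * Complex.I)‖|) ?_ ?_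
    (hF.intervalIntegrable_log hy 0 1).abs ?_
  · filter_upwards [self_mem_nhdsWithin] with η hη
    exact ((hc.max continuous_const).log fun x =>
      (lt_max_of_lt_right hη).ne').aestronglyMeasurable
  · filter_upwards [Ioc_mem_nhdsGT one_pos] with η hη
    filter_upwards [hF.ae_ne_zero h0 hy] with x hx _
    rw [Real.norm_eq_abs]
    rcases le_total η ‖F ((x : ℂ) + (y : ℂ) * Complex.I)‖ with h | h
    · rw [max_eq_left h]
    · rw [max_eq_right h]
      have h1 := Real.log_le_log (norm_pos_iff.2 hx) h
      have h2 := Real.log_nonpos hη.1.le hη.2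
      rw [abs_of_nonpos h2, abs_of_nonpos (h1.trans h2)]
      linarith
  · filter_upwards [hF.ae_ne_zero h0 hy] with x hx _
    refine tendsto_const_nhds.congr' ?_
    filter_upwards [Ioc_mem_nhdsGT (norm_pos_iff.2 hx)] with η hη
    rw [max_eq_left hη.2]

/-- The three lines theorem is applied to the product of the `q` translates `F (z + k / q)`. On the
outer lines the logarithm of the product is at most a Riemann sum, hence at most `q` times the mean
plus `q ε`. On the inner line the mean of its logarithm is exactly `q` times that of `F`. Truncating
at `η` keeps the logarithm continuous at zeros of `F`. -/
theorem logMean_le_of_pos (hF : IsStripAnalytic ρ F) (h0 : ∃ z ∈ closedStrip ρ, F z ≠ 0)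
    {a c θ : ℝ} (ha : |a| ≤ ρ) (hc : |c| ≤ ρ) (hac : a < c) (hθ : θ ∈ Set.Icc (0 : ℝ) 1)
    {η ε : ℝ} (hη : 0 < η) (hε : 0 < ε) :
    logMean F ((1 - θ) * a + θ * c) ≤
      (1 - θ) * (∫ x in (0 : ℝ)..1, Real.log (max ‖F ((x : ℂ) + (a : ℂ) * Complex.I)‖ η)) +
      θ * (∫ x in (0 : ℝ)..1, Real.log (max ‖F ((x : ℂ) + (c : ℂ) * Complex.I)‖ η)) + ε := by
  have hb : |(1 - θ) * a + θ * c| ≤ ρ := by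
    obtain ⟨h1, h2⟩ := hθ
    rw [abs_le] at ha hc ⊢
    constructor <;> nlinarith
  have hρ : 0 ≤ ρ := (abs_nonneg a).trans ha
  have hR : ∀ y : ℝ, |y| ≤ ρ → ∃ q₀ : ℕ, ∀ q : ℕ, q₀ ≤ q → ∀ x : ℝ,
      ‖∏ k ∈ Finset.range q, F ((x : ℂ) + (y : ℂ) * Complex.I + (((k : ℝ) / q : ℝ) : ℂ))‖ ≤
        Real.exp (q * ((∫ s in (0 : ℝ)..1,
          Real.log (max ‖F ((s : ℂ) + (y : ℂ) * Complex.I)‖ η)) + ε)) := by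
    intro y hy
    have hpos : ∀ s : ℝ, 0 < max ‖F ((s : ℂ) + (y : ℂ) * Complex.I)‖ η := fun s =>
      lt_max_of_lt_right hη
    have hp : Function.Periodic
        (fun s : ℝ => Real.log (max ‖F ((s : ℂ) + (y : ℂ) * Complex.I)‖ η)) 1 := fun s => by
      have := hF.periodic_line hy s
      simp only at this ⊢
      rw [this]
    obtain ⟨q₀, hq₀⟩ := hp.exists_riemann_sum_le
      (((hF.continuous_line hy).norm.max continuous_const).log fun s => (hpos s).ne') hε
    refine ⟨q₀, fun q hq x => le_trans ?_ (Real.exp_le_exp.2 (hq₀ q hq x))⟩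
    rw [Real.exp_sum, norm_prod]
    refine Finset.prod_le_prod (fun _ _ => norm_nonneg _) fun k _ => ?_
    rw [Real.exp_log (hpos _)]
    refine le_trans (le_of_eq ?_) (le_max_left _ _)
    push_cast
    ring_nf
  obtain ⟨qa, hqa⟩ := hR a ha
  obtain ⟨qc, hqc⟩ := hR c hc
  set q : ℕ := max (max qa qc) 1 with hq
  have hq0 : (0 : ℝ) < q := by
    have : 1 ≤ q := le_max_right _ _
    exact_mod_cast this
  have hG : ∀ k ∈ Finset.range q, IsStripAnalytic ρ (fun z => F (z + (((k : ℝ) / q : ℝ) : ℂ))) :=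
    fun k _ => hF.comp_add_ofReal _
  have hG0 : ∀ k ∈ Finset.range q, ∃ z ∈ closedStrip ρ, F (z + (((k : ℝ) / q : ℝ) : ℂ)) ≠ 0 := by
    intro k _
    obtain ⟨z, hz, hz0⟩ := h0
    refine ⟨z + ((-((k : ℝ) / q) : ℝ) : ℂ), add_ofReal_mem_closedStrip hz _, ?_⟩
    rw [add_assoc, ← Complex.ofReal_add, neg_add_cancel, Complex.ofReal_zero, add_zero]
    exact hz0
  have hP := finset_prod hG
  have h1 := hP.logMean_le_log (exists_prod_ne_zero _ hρ hG hG0) hb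
    (hP.norm_le_of_three_lines ha hc hac hθ
      (hqa q ((le_max_left _ _).trans (le_max_left _ _)))
      (hqc q ((le_max_right _ _).trans (le_max_left _ _))))
  rw [logMean_prod _ hG hG0 hb, Finset.sum_congr rfl fun (k : ℕ) _ =>
    hF.logMean_comp_add_ofReal hb ((k : ℝ) / q), Finset.sum_const, Finset.card_range, nsmul_eq_mul,
    ← Real.exp_mul, ← Real.exp_mul, ← Real.exp_add, Real.log_exp] at h1
  refine le_of_mul_le_mul_left (h1.trans (le_of_eq ?_)) hq0
  ring

/-- The mean of `log |F|` on horizontal lines is a convex function of the height. -/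
theorem logMean_convex (hF : IsStripAnalytic ρ F) (h0 : ∃ z ∈ closedStrip ρ, F z ≠ 0)
    {a c θ : ℝ} (ha : |a| ≤ ρ) (hc : |c| ≤ ρ) (hac : a < c) (hθ : θ ∈ Set.Icc (0 : ℝ) 1) :
    logMean F ((1 - θ) * a + θ * c) ≤ (1 - θ) * logMean F a + θ * logMean F c := by
  refine le_of_forall_pos_le_add fun ε hε => ?_
  refine ge_of_tendsto ((((hF.tendsto_integral_log_max h0 ha).const_mul (1 - θ)).add
    ((hF.tendsto_integral_log_max h0 hc).const_mul θ)).add_const ε) ?_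
  filter_upwards [self_mem_nhdsWithin] with η hη
  exact hF.logMean_le_of_pos h0 ha hc hac hθ hη hε

end IsStripAnalytic

/-! ### Comparison of logarithmic means at different heights. -/

namespace IsStripAnalytic

variable {ρ : ℝ} {F G : ℂ → ℂ}

theorem log_add_logMean_le (hF : IsStripAnalytic ρ F) (hG : IsStripAnalytic ρ G)
    (h0 : ∃ z ∈ closedStrip ρ, G z ≠ 0) {y m : ℝ} (hy : |y| ≤ ρ) (hm : 0 < m)
    (h : ∀ x : ℝ, m * ‖G ((x : ℂ) + (y : ℂ) * Complex.I)‖ ≤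
      ‖F ((x : ℂ) + (y : ℂ) * Complex.I)‖) :
    Real.log m + logMean G y ≤ logMean F y := by
  have h1 : (∫ x in (0 : ℝ)..1, (Real.log m +
      Real.log ‖G ((x : ℂ) + (y : ℂ) * Complex.I)‖)) ≤ logMean F y := by
    refine intervalIntegral.integral_mono_ae zero_le_one
      (intervalIntegrable_const.add (hG.intervalIntegrable_log hy 0 1))
      (hF.intervalIntegrable_log hy 0 1) ?_
    filter_upwards [hG.ae_ne_zero h0 hy] with x hx
    have hx' := norm_pos_iff.2 hx
    rw [← Real.log_mul hm.ne' hx'.ne']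
    exact Real.log_le_log (by positivity) (h x)
  rw [intervalIntegral.integral_add intervalIntegrable_const
    (hG.intervalIntegrable_log hy 0 1)] at h1
  simpa [logMean] using h1

theorem log_le_logMean (hF : IsStripAnalytic ρ F) {y m : ℝ} (hy : |y| ≤ ρ) (hm : 0 < m)
    (h : ∀ x : ℝ, m ≤ ‖F ((x : ℂ) + (y : ℂ) * Complex.I)‖) : Real.log m ≤ logMean F y := by
  have h1 := hF.log_add_logMean_le (G := fun _ => 1) (const 1)
    ⟨_, line_mem_closedStrip hy 0, one_ne_zero⟩ hy hm (fun x => by simpa using h x)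
  simpa [logMean] using h1

/-- A lower bound of the mean on the real axis by means on two lines in the upper half plane. -/
theorem sub_le_logMean_zero (hF : IsStripAnalytic ρ F) (h0 : ∃ z ∈ closedStrip ρ, F z ≠ 0)
    {y₁ y₂ L U : ℝ} (hy₁ : 0 < y₁) (hy : 2 * y₁ ≤ y₂) (hy₂ : y₂ ≤ ρ) (hL : L ≤ logMean F y₁)
    (hU : logMean F y₂ ≤ U) (hLU : L ≤ U) : L - 2 * y₁ / y₂ * (U - L) ≤ logMean F 0 := by
  have hy₂0 : 0 < y₂ := by linarith
  -- Convexity between `0` and `y₂` gives the loss `θ / (1 - θ) * (U - L)`, and `θ ≤ 1/2` bounds the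
  -- factor by `2 θ`.
  set θ : ℝ := y₁ / y₂ with hθ
  have hθ0 : 0 ≤ θ := by positivity
  have hθ1 : θ ≤ 1 / 2 := by
    rw [hθ, div_le_iff₀ hy₂0]
    linarith
  have h1 := hF.logMean_convex h0 (a := 0) (c := y₂) (θ := θ)
    (by rw [abs_zero]; linarith) (by rw [abs_of_pos hy₂0]; exact hy₂) hy₂0 ⟨hθ0, by linarith⟩
  have h2 : (1 - θ) * 0 + θ * y₂ = y₁ := by
    rw [hθ]
    field_simp
    ring
  rw [h2] at h1
  have h3 : 2 * y₁ / y₂ = 2 * θ := by rw [hθ]; ring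
  rw [h3]
  have h4 : θ * logMean F y₂ ≤ θ * U := by gcongr
  have h5 : 0 ≤ θ * (1 - 2 * θ) * (U - L) :=
    mul_nonneg (mul_nonneg hθ0 (by linarith)) (by linarith)
  have h6 : (1 - θ) * (L - 2 * θ * (U - L)) ≤ (1 - θ) * logMean F 0 := by nlinarith
  exact le_of_mul_le_mul_left h6 (by linarith)

end IsStripAnalytic

-- Schwarz reflection: both sides, as analytic functions of `z` after conjugation, agree on the real
-- axis.
open ComplexConjugate Filter Topology in
theorem IsPotential.apply_conj {ρ : ℝ} {f : ℂ → ℂ} (hf : IsPotential ρ f) (hρ : 0 ≤ ρ) {z : ℂ}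
    (hz : z ∈ closedStrip ρ) : f (conj z) = conj (f z) := by
  have hconj : ∀ z ∈ closedStrip ρ, conj z ∈ closedStrip ρ := fun z hz => by
    simpa [mem_closedStrip] using hz
  have hA : AnalyticOnNhd ℂ (fun z => conj (f (conj z))) (closedStrip ρ) := by
    intro z hz
    rw [Complex.analyticAt_iff_eventually_differentiableAt]
    have h1 := (hf.analytic _ (hconj z hz)).eventually_analyticAt
    have h2 : Tendsto (fun w : ℂ => conj w) (𝓝 z) (𝓝 (conj z)) :=
      Complex.continuous_conj.tendsto z
    filter_upwards [h2.eventually h1] with w hw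
    have h3 := hw.differentiableAt.conj_conj
    rw [Complex.conj_conj] at h3
    exact h3
  have h0 : ((0 : ℝ) : ℂ) ∈ closedStrip ρ := by simpa [mem_closedStrip] using hρ
  have ht : Tendsto (fun x : ℝ => (x : ℂ)) (𝓝[≠] 0) (𝓝[≠] ((0 : ℝ) : ℂ)) := by
    refine tendsto_nhdsWithin_iff.2
      ⟨(Complex.continuous_ofReal.tendsto 0).mono_left nhdsWithin_le_nhds, ?_⟩
    filter_upwards [self_mem_nhdsWithin] with x hx
    simpa using hx
  have h := hA.eqOn_of_preconnected_of_frequently_eq hf.analytic (isPreconnected_closedStrip ρ) h0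
    (ht.frequently (Eventually.frequently (.of_forall fun x => by
      rw [Complex.conj_ofReal, Complex.conj_eq_iff_im.2 (hf.real x)]))) hz
  rw [← h]
  simp

theorem IsPotential.logMean_neg {ρ : ℝ} {f : ℂ → ℂ} (hf : IsPotential ρ f) {y : ℝ} (hy : |y| ≤ ρ)
    (E : ℝ) : logMean (fun z => f z - (E : ℂ)) (-y) = logMean (fun z => f z - (E : ℂ)) y := by
  unfold logMean
  refine intervalIntegral.integral_congr fun x _ => ?_
  simp only
  have h := hf.apply_conj ((abs_nonneg y).trans hy) (line_mem_closedStrip hy x)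
  have h1 : (x : ℂ) + ((-y : ℝ) : ℂ) * Complex.I =
      (starRingEnd ℂ) ((x : ℂ) + (y : ℂ) * Complex.I) := by simp
  rw [h1, h, ← Complex.norm_conj]
  simp

/-- A convex even function of the height is smallest at `0`. -/
theorem IsPotential.logMean_zero_le {ρ : ℝ} {f : ℂ → ℂ} (hf : IsPotential ρ f) {y : ℝ}
    (hy0 : 0 < y) (hy : y ≤ ρ) (E : ℝ) (h0 : ∃ z ∈ closedStrip ρ, f z - (E : ℂ) ≠ 0) :
    logMean (fun z => f z - (E : ℂ)) 0 ≤ logMean (fun z => f z - (E : ℂ)) y := by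
  have hy' : |y| ≤ ρ := by rwa [abs_of_pos hy0]
  have h := (hf.isStripAnalytic.sub_const E).logMean_convex h0 (a := -y) (c := y) (θ := 1 / 2)
    (by rwa [abs_neg]) hy' (by linarith) ⟨by norm_num, by norm_num⟩
  rw [hf.logMean_neg hy', show (1 - 1 / 2 : ℝ) * -y + 1 / 2 * y = 0 by ring] at h
  linarith

/-! ### The Dirichlet determinant as a perturbation of its diagonal. -/

theorem Matrix.norm_apply_le_toEuclideanCLM {l : ℕ} (A : Matrix (Fin l) (Fin l) ℂ) (i j : Fin l) :
    ‖A i j‖ ≤ ‖Matrix.toEuclideanCLM (𝕜 := ℂ) A‖ := by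
  have h1 := (Matrix.toEuclideanCLM (𝕜 := ℂ) A).le_opNorm (EuclideanSpace.single j 1)
  rw [PiLp.norm_single, norm_one, mul_one] at h1
  refine le_trans ?_ ((PiLp.norm_apply_le _ i).trans h1)
  rw [Matrix.ofLp_toEuclideanCLM]
  simp

theorem summable_exp_neg_mul_abs {ρ : ℝ} (hρ : 0 < ρ) :
    Summable fun k : ℤ => Real.exp (-ρ * |(k : ℝ)|) := by
  have h : Summable fun n : ℕ => Real.exp (-ρ * (n : ℝ)) := by
    have := Real.summable_exp_nat_mul_iff.2 (neg_lt_zero.2 hρ)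
    simpa [mul_comm] using this
  refine Summable.of_nat_of_neg ?_ ?_ <;> simpa using h

/-- Along a row each site difference occurs once, so the row sums are controlled by the full series,
uniformly in `N`. -/
theorem IsHopping.sum_norm_le {l : ℕ} {ρ : ℝ} (hρ : 0 < ρ) {W : ℤ → Matrix (Fin l) (Fin l) ℂ}
    (hW : IsHopping ρ W) (N : ℕ) (p : Fin N × Fin l) :
    ∑ q : Fin N × Fin l, ‖W ((((p.1 : ℕ) : ℤ) + 1) - (((q.1 : ℕ) : ℤ) + 1)) p.2 q.2‖ ≤
      l * ∑' k : ℤ, Real.exp (-ρ * |(k : ℝ)|) := by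
  rw [Fintype.sum_prod_type]
  have hinj : Function.Injective
      fun i : Fin N => (((p.1 : ℕ) : ℤ) + 1) - (((i : ℕ) : ℤ) + 1) := fun i i' h => by
    simp only at h
    exact Fin.ext (by omega)
  calc _ ≤ ∑ i : Fin N, ∑ _j : Fin l,
        Real.exp (-ρ * |(((((p.1 : ℕ) : ℤ) + 1) - (((i : ℕ) : ℤ) + 1) : ℤ) : ℝ)|) :=
        Finset.sum_le_sum fun i _ => Finset.sum_le_sum fun j _ =>
          (Matrix.norm_apply_le_toEuclideanCLM _ _ _).trans (hW.decay _)
    _ = l * ∑ k ∈ Finset.univ.map ⟨_, hinj⟩, Real.exp (-ρ * |(k : ℝ)|) := by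
        simp only [Finset.sum_const, Finset.card_univ, Fintype.card_fin, nsmul_eq_mul,
          Finset.sum_map, Function.Embedding.coeFn_mk]
        rw [Finset.mul_sum]
    _ ≤ _ := by
        gcongr
        exact (summable_exp_neg_mul_abs hρ).sum_le_tsum _ fun _ _ => (Real.exp_pos _).le

section Dirichlet

variable {l : ℕ} {ρ ε ω : ℝ} {W : ℤ → Matrix (Fin l) (Fin l) ℂ} {v : Fin l → ℂ → ℂ}

/-- The diagonal part of `H_N - E`. -/
noncomputable def diagonalPart (ω : ℝ) (v : Fin l → ℂ → ℂ) (N : ℕ) (E : ℝ) (z : ℂ)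
    (p : Fin N × Fin l) : ℂ :=
  v p.2 (z + (((((p.1 : ℕ) : ℝ) + 1) * ω : ℝ) : ℂ)) - (E : ℂ)

/-- The off-diagonal part of `H_N - E`, with the hopping inside a site included. -/
noncomputable def hoppingPart (ε : ℝ) (W : ℤ → Matrix (Fin l) (Fin l) ℂ) (N : ℕ) :
    Matrix (Fin N × Fin l) (Fin N × Fin l) ℂ :=
  Matrix.of fun p q => (ε : ℂ) * W ((((p.1 : ℕ) : ℤ) + 1) - (((q.1 : ℕ) : ℤ) + 1)) p.2 q.2

theorem dirichletDet_eq (ε ω : ℝ) (W : ℤ → Matrix (Fin l) (Fin l) ℂ) (v : Fin l → ℂ → ℂ) (N : ℕ)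
    (E : ℝ) (z : ℂ) :
    dirichletDet ε ω W v N E z =
      (Matrix.diagonal (diagonalPart ω v N E z) + hoppingPart ε W N).det := by
  unfold dirichletDet
  congr 1
  ext ⟨i, j⟩ ⟨i', j'⟩
  by_cases hi : i = i'
  · subst hi
    by_cases hj : j = j'
    · subst hj
      simp [dirichletMatrix, blockEntry, diagonalPart, hoppingPart]
      ring
    · simp [dirichletMatrix, blockEntry, hoppingPart, hj]
  · have h : (i : ℕ) ≠ (i' : ℕ) := fun h => hi (Fin.ext h)
    simp [dirichletMatrix, blockEntry, hoppingPart, hi, h]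

theorem isStripAnalytic_diagonalPart (hv : ∀ j, IsPotential ρ (v j)) (N : ℕ) (E : ℝ)
    (p : Fin N × Fin l) : IsStripAnalytic ρ (fun z => diagonalPart ω v N E z p) :=
  ((hv p.2).isStripAnalytic.sub_const E).comp_add_ofReal _

theorem isStripAnalytic_dirichletDet (hv : ∀ j, IsPotential ρ (v j)) (N : ℕ) (E : ℝ) :
    IsStripAnalytic ρ (dirichletDet ε ω W v N E) := by
  simp only [funext (dirichletDet_eq ε ω W v N E)]
  refine IsStripAnalytic.matrix_det fun p q => ?_
  by_cases hpq : p = q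
  · subst hpq
    simp only [Matrix.add_apply, Matrix.diagonal_apply_eq]
    have := (isStripAnalytic_diagonalPart (ω := ω) hv N E p).const_add (hoppingPart ε W N p p)
    simpa only [add_comm] using this
  · simp only [Matrix.add_apply, Matrix.diagonal_apply_ne _ hpq]
    exact IsStripAnalytic.const _

theorem sum_norm_hoppingPart_le (hρ : 0 < ρ) (hW : IsHopping ρ W) (hε : 0 ≤ ε) (N : ℕ)
    (p : Fin N × Fin l) :
    ∑ q, ‖hoppingPart ε W N p q‖ ≤ ε * (l * ∑' k : ℤ, Real.exp (-ρ * |(k : ℝ)|)) := by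
  simp only [hoppingPart, Matrix.of_apply, norm_mul, Complex.norm_real, Real.norm_eq_abs,
    abs_of_nonneg hε, ← Finset.mul_sum]
  gcongr
  exact hW.sum_norm_le hρ N p

theorem norm_dirichletDet_le (hρ : 0 < ρ) (hW : IsHopping ρ W) (hε : 0 ≤ ε) (hε1 : ε ≤ 1) (N : ℕ)
    {M : ℝ} (hM : ∀ j, ∀ z ∈ closedStrip ρ, ‖v j z‖ ≤ M) (E : ℝ) {z : ℂ}
    (hz : z ∈ closedStrip ρ) :
    ‖dirichletDet ε ω W v N E z‖ ≤
      (M + |E| + l * ∑' k : ℤ, Real.exp (-ρ * |(k : ℝ)|)) ^ (N * l) := by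
  rw [dirichletDet_eq]
  have h1 := Matrix.norm_det_le_pow (A := Matrix.diagonal (diagonalPart ω v N E z) +
    hoppingPart ε W N) (R := M + |E| + l * ∑' k : ℤ, Real.exp (-ρ * |(k : ℝ)|)) fun p => ?_
  · simpa using h1
  have h2 : ∑ q, ‖Matrix.diagonal (diagonalPart ω v N E z) p q‖ = ‖diagonalPart ω v N E z p‖ := by
    rw [Finset.sum_eq_single p (fun q _ hq => by
      rw [Matrix.diagonal_apply_ne _ hq.symm, norm_zero]) (by simp), Matrix.diagonal_apply_eq]
  have h3 : ‖diagonalPart ω v N E z p‖ ≤ M + |E| := by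
    refine (norm_sub_le _ _).trans ?_
    rw [Complex.norm_real, Real.norm_eq_abs]
    gcongr
    exact hM _ _ (add_ofReal_mem_closedStrip hz _)
  have h4 : 0 ≤ (l : ℝ) * ∑' k : ℤ, Real.exp (-ρ * |(k : ℝ)|) :=
    mul_nonneg (by positivity) (tsum_nonneg fun _ => (Real.exp_pos _).le)
  have h5 := sum_norm_hoppingPart_le hρ hW hε N p
  calc _ ≤ ∑ q, (‖Matrix.diagonal (diagonalPart ω v N E z) p q‖ + ‖hoppingPart ε W N p q‖) :=
        Finset.sum_le_sum fun q _ => norm_add_le _ _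
    _ ≤ _ := by
        rw [Finset.sum_add_distrib, h2]
        nlinarith

/-- The lower bound for the Dirichlet determinant on a line on which the potentials stay away from
the energy. -/
theorem le_logMean_dirichletDet (hρ : 0 < ρ) (hv : ∀ j, IsPotential ρ (v j))
    (hW : IsHopping ρ W) (hε : 0 ≤ ε) (N : ℕ) {E y m τ : ℝ} (hy : |y| ≤ ρ) (hm : 0 < m)
    (hτ0 : 0 ≤ τ) (hτ : τ ≤ 1 / 2)
    (hmv : ∀ (x : ℝ) (j : Fin l), m ≤ ‖v j ((x : ℂ) + (y : ℂ) * Complex.I) - (E : ℂ)‖)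
    (hετ : ε * (l * ∑' k : ℤ, Real.exp (-ρ * |(k : ℝ)|)) ≤ τ * m) :
    (∃ z ∈ closedStrip ρ, dirichletDet ε ω W v N E z ≠ 0) ∧
      N * ∑ j, logMean (fun z => v j z - (E : ℂ)) y - 2 * τ * (N * l) ≤
        logMean (dirichletDet ε ω W v N E) y := by
  have hd : ∀ (x : ℝ) (p : Fin N × Fin l),
      m ≤ ‖diagonalPart ω v N E ((x : ℂ) + (y : ℂ) * Complex.I) p‖ := fun x p => by
    have h := hmv (x + ((p.1 : ℕ) + 1) * ω) p.2
    rw [diagonalPart]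
    refine h.trans (le_of_eq ?_)
    push_cast
    ring_nf
  have hpt : ∀ x : ℝ, (1 - τ) ^ (N * l) *
      ‖∏ p, diagonalPart ω v N E ((x : ℂ) + (y : ℂ) * Complex.I) p‖ ≤
        ‖dirichletDet ε ω W v N E ((x : ℂ) + (y : ℂ) * Complex.I)‖ := fun x => by
    have h := Matrix.prod_mul_pow_le_norm_det_diagonal_add
      (diagonalPart ω v N E ((x : ℂ) + (y : ℂ) * Complex.I))
      (fun p => norm_pos_iff.1 (hm.trans_le (hd x p))) (hoppingPart ε W N) (τ := τ) (by linarith)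
      (fun p => ((sum_norm_hoppingPart_le hρ hW hε N p).trans hετ).trans
        (mul_le_mul_of_nonneg_left (hd x p) hτ0))
    rw [dirichletDet_eq, norm_prod, mul_comm]
    simpa using h
  have hprod : ∀ x : ℝ,
      0 < ‖∏ p, diagonalPart ω v N E ((x : ℂ) + (y : ℂ) * Complex.I) p‖ := fun x => by
    rw [norm_prod]
    exact Finset.prod_pos fun p _ => hm.trans_le (hd x p)
  have hτ' : 0 < 1 - τ := by linarith
  have hmem := line_mem_closedStrip hy 0
  refine ⟨⟨_, hmem, norm_pos_iff.1 (lt_of_lt_of_le (mul_pos (by positivity) (hprod 0)) (hpt 0))⟩, ?_⟩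
  have hdA : ∀ p ∈ (Finset.univ : Finset (Fin N × Fin l)),
      IsStripAnalytic ρ (fun z => diagonalPart ω v N E z p) :=
    fun p _ => isStripAnalytic_diagonalPart hv N E p
  have h1 := (isStripAnalytic_dirichletDet (ε := ε) (ω := ω) (W := W) hv N E).log_add_logMean_le
    (IsStripAnalytic.finset_prod hdA) ⟨_, hmem, norm_pos_iff.1 (hprod 0)⟩ hy (by positivity) hpt
  rw [IsStripAnalytic.logMean_prod _ hdA (fun p _ => ⟨_, hmem, norm_pos_iff.1 (hm.trans_le (hd 0 p))⟩)
    hy] at h1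
  -- A real translation does not change the mean over a period, so the frequency drops out and all
  -- sites contribute equally.
  have h2 : ∑ p : Fin N × Fin l, logMean (fun z => diagonalPart ω v N E z p) y =
      N * ∑ j, logMean (fun z => v j z - (E : ℂ)) y := by
    have h3 : ∀ p : Fin N × Fin l, logMean (fun z => diagonalPart ω v N E z p) y =
        logMean (fun z => v p.2 z - (E : ℂ)) y := fun p =>
      ((hv p.2).isStripAnalytic.sub_const E).logMean_comp_add_ofReal hy _
    simp only [h3]
    rw [Fintype.sum_prod_type]
    simp
  rw [h2, Real.log_pow] at h1
  have h4 : -(2 * τ) ≤ Real.log (1 - τ) := by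
    refine le_trans ?_ (Real.one_sub_inv_le_log_of_pos hτ')
    have h5 : (1 - τ)⁻¹ ≤ 1 + 2 * τ := by
      rw [inv_le_iff_one_le_mul₀ hτ']
      nlinarith
    linarith
  have h6 : ((N * l : ℕ) : ℝ) * -(2 * τ) ≤ ((N * l : ℕ) : ℝ) * Real.log (1 - τ) := by gcongr
  push_cast at h1 h6
  linarith

end Dirichlet

/-! ### Uniformity in the energy and choice of constants. -/

/-- The mean of `log |v j - E|` on the real axis is at least `log (1 + |E|) - C` uniformly in `E`. -/
theorem exists_log_sub_le_logMean {l : ℕ} {ρ M δ₀ c : ℝ} {S : ℕ} {v : Fin l → ℂ → ℂ}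
    (hv : ∀ j, IsPotential ρ (v j)) (hM : ∀ j, ∀ z ∈ closedStrip ρ, ‖v j z‖ ≤ M) (hM1 : 1 ≤ M)
    (hδ₀ : 0 < δ₀) (hδ₀ρ : δ₀ ≤ ρ) (hc : 0 < c)
    (hgood : ∀ E δ : ℝ, 0 < δ → δ ≤ δ₀ → ∃ y ∈ Set.Ioo 0 δ,
      ∀ (x : ℝ) (j : Fin l),
        c * δ ^ S * (1 + |E|) ≤ ‖v j ((x : ℂ) + (y : ℂ) * Complex.I) - E‖) :
    ∃ C ≥ 0, ∀ (E : ℝ) (j : Fin l),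
      Real.log (1 + |E|) - C ≤ logMean (fun z => v j z - (E : ℂ)) 0 := by
  set m : ℝ := c * (δ₀ / 2) ^ S with hm
  have hm0 : 0 < m := by positivity
  refine ⟨max (Real.log M - 2 * Real.log m) 0, le_max_right _ _, fun E j => ?_⟩
  obtain ⟨y, hy, hyb⟩ := hgood E (δ₀ / 2) (by positivity) (by linarith)
  have hE : 0 < 1 + |E| := by positivity
  have hF := (hv j).isStripAnalytic.sub_const E
  have hyρ : |y| ≤ ρ := by
    rw [abs_of_pos hy.1]
    linarith [hy.2]
  have hmE : 0 < m * (1 + |E|) := by positivity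
  have hup : ∀ z ∈ closedStrip ρ, ‖v j z - (E : ℂ)‖ ≤ M * (1 + |E|) := by
    intro z hz
    refine (norm_sub_le _ _).trans ?_
    rw [Complex.norm_real, Real.norm_eq_abs]
    have := hM j z hz
    nlinarith [abs_nonneg E]
  have h0 : ∃ z ∈ closedStrip ρ, v j z - (E : ℂ) ≠ 0 :=
    ⟨_, line_mem_closedStrip hyρ 0, norm_pos_iff.1 (hmE.trans_le (hyb 0 j))⟩
  have h1 := hF.log_le_logMean hyρ hmE (fun x => hyb x j)
  have h2 := hF.logMean_le_log h0 (y := δ₀) (by rwa [abs_of_pos hδ₀])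
    (fun x => hup _ (line_mem_closedStrip (by rwa [abs_of_pos hδ₀]) x))
  -- The bounds at heights `y` and `δ₀` both contain `log (1 + |E|)`, so their gap is `log M - log
  -- m`. As `2 y ≤ δ₀`, at most this gap is lost.
  have h3 := hF.sub_le_logMean_zero h0 hy.1 (by linarith [hy.2]) hδ₀ρ h1 h2
    (Real.log_le_log hmE ((hyb 0 j).trans (hup _ (line_mem_closedStrip hyρ 0))))
  have h4 : Real.log (m * (1 + |E|)) ≤ Real.log (M * (1 + |E|)) :=
    Real.log_le_log hmE ((hyb 0 j).trans (hup _ (line_mem_closedStrip hyρ 0)))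
  have h5 : 2 * y / δ₀ ≤ 1 := by
    rw [div_le_one hδ₀]
    linarith [hy.2]
  have h6 : 2 * y / δ₀ * (Real.log (M * (1 + |E|)) - Real.log (m * (1 + |E|))) ≤
      1 * (Real.log (M * (1 + |E|)) - Real.log (m * (1 + |E|))) := by
    gcongr
  rw [Real.log_mul hm0.ne' hE.ne', Real.log_mul (by positivity) hE.ne'] at h3 h6
  have h7 := le_max_left (Real.log M - 2 * Real.log m) 0
  linarith

theorem mainTheorem3 {l : ℕ} (hl : 0 < l) {ρ : ℝ} (hρ : 0 < ρ)
    (v : Fin l → ℂ → ℂ) (hv : ∀ j, IsPotential ρ (v j)) :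
    ∃ S : ℕ, (S : ℕ∞) = zeroBound ρ v ∧ 0 < S ∧
      ∃ ε₀ > (0 : ℝ), ∃ C > (0 : ℝ),
        ∀ ε : ℝ, 0 < ε → ε ≤ ε₀ → ∀ t : ℝ, 0 < t →
          ∃ N₀ : ℕ, ∀ ω ∈ DC t, ∀ W : ℤ → Matrix (Fin l) (Fin l) ℂ, IsHopping ρ W →
            ∀ a b : ℝ, ∀ E ∈ Set.Icc a b, ∀ N : ℕ, N₀ ≤ N →
              (∀ᵐ x : ℝ, dirichletDet ε ω W v N E (x : ℂ) ≠ 0) ∧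
              IntervalIntegrable
                (fun x : ℝ => Real.log ‖dirichletDet ε ω W v N E (x : ℂ)‖)
                MeasureTheory.volume 0 1 ∧
              (∀ j, IntervalIntegrable
                (fun x : ℝ => Real.log ‖v j (x : ℂ) - (E : ℂ)‖)
                MeasureTheory.volume 0 1) ∧
              (1 / (N : ℝ)) *
                  (∫ x in (0 : ℝ)..1, Real.log ‖dirichletDet ε ω W v N E (x : ℂ)‖) ≥
                (∑ j, ∫ x in (0 : ℝ)..1, Real.log ‖v j (x : ℂ) - (E : ℂ)‖) -
                  C * (l : ℝ) * ε ^ (1 / (2 * (S : ℝ))) := by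
  obtain ⟨S, hS⟩ := ENat.ne_top_iff_exists.1 (zeroBound_ne_top hρ.le hv)
  have hS0 : 0 < S := by
    have h := ((hv ⟨0, hl⟩).one_le_zeroCount hρ.le).trans (zeroCount_le_zeroBound v _ _)
    rw [← hS] at h
    exact_mod_cast h
  refine ⟨S, hS, hS0, ?_⟩
  obtain ⟨δ₀, hδ₀, hδ₀ρ, c, hc, hgood⟩ := exists_good_line hρ hv hS
  choose Mj hMj hMjb using fun j => (hv j).isStripAnalytic.exists_norm_le
  set M : ℝ := 1 + ∑ j, Mj j with hMdef
  have hM1 : 1 ≤ M := by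
    have : 0 ≤ ∑ j, Mj j := Finset.sum_nonneg fun j _ => (hMj j).le
    linarith
  have hM : ∀ j, ∀ z ∈ closedStrip ρ, ‖v j z‖ ≤ M := fun j z hz => by
    have h1 := Finset.single_le_sum (fun i _ => (hMj i).le) (Finset.mem_univ j)
    linarith [hMjb j z hz]
  obtain ⟨C₂, hC₂, hJ⟩ := exists_log_sub_le_logMean hv hM hM1 hδ₀ hδ₀ρ hc hgood
  set K : ℝ := l * ∑' k : ℤ, Real.exp (-ρ * |(k : ℝ)|) with hKdef
  have hl0 : (0 : ℝ) < l := by exact_mod_cast hl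
  have hK : 0 < K := mul_pos hl0 ((summable_exp_neg_mul_abs hρ).tsum_pos
    (fun _ => (Real.exp_pos _).le) 0 (Real.exp_pos _))
  set B : ℝ := M + K with hB
  have hB1 : 1 ≤ B := by linarith
  set C₃ : ℝ := Real.log B + C₂ + 1 with hC₃
  have hC₃0 : 0 < C₃ := by linarith [Real.log_nonneg hB1]
  -- An upper bound for `δ`: the first term gives `2 y ≤ δ₀`, the second `τ ≤ 1/2`, the third `δ ^ S
  -- ≤ δ` and `ε ≤ 1`.
  set μ : ℝ := min (min (δ₀ / 2) (c / (2 * K))) 1 with hμ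
  have hμ0 : 0 < μ := by positivity
  refine ⟨μ ^ (2 * S), by positivity, 2 * (K / c) + 2 / δ₀ * C₃, by positivity,
    fun ε hε hεμ t _ => ⟨1, fun ω _ W hW _ _ E _ N hN => ?_⟩⟩
  set δ : ℝ := ε ^ (1 / (2 * (S : ℝ))) with hδ
  have hδ0 : 0 < δ := Real.rpow_pos_of_pos hε _
  have h2S : 2 * S ≠ 0 := by omega
  have hexp : 1 / (2 * (S : ℝ)) = (((2 * S : ℕ) : ℝ))⁻¹ := by push_cast; rw [one_div]
  have hδpow : δ ^ (2 * S) = ε := by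
    rw [hδ, hexp, Real.rpow_inv_natCast_pow hε.le h2S]
  have hδμ : δ ≤ μ := le_of_pow_le_pow_left₀ h2S hμ0.le (hδpow.le.trans hεμ)
  have hδ1 : δ ≤ 1 := hδμ.trans (min_le_right _ _)
  have hδδ₀ : δ ≤ δ₀ / 2 := hδμ.trans ((min_le_left _ _).trans (min_le_left _ _))
  have hδK : δ ≤ c / (2 * K) := hδμ.trans ((min_le_left _ _).trans (min_le_right _ _))
  have hε1 : ε ≤ 1 := by
    rw [← hδpow]
    exact pow_le_one₀ hδ0.le hδ1
  set τ : ℝ := K / c * δ with hτ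
  have hτ0 : 0 ≤ τ := by positivity
  have hτ2 : τ ≤ 1 / 2 := by
    calc τ ≤ K / c * (c / (2 * K)) := by rw [hτ]; gcongr
      _ = 1 / 2 := by field_simp
  have hE : 1 ≤ 1 + |E| := by linarith [abs_nonneg E]
  obtain ⟨y, hy, hyb⟩ := hgood E δ hδ0 (by linarith)
  have hyρ : |y| ≤ ρ := by
    rw [abs_of_pos hy.1]
    linarith [hy.2]
  have hδ₀ρ' : |δ₀| ≤ ρ := by rwa [abs_of_pos hδ₀]
  have hm : 0 < c * δ ^ S * (1 + |E|) := by positivity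
  -- This explains the exponent `1 / (2 S)`: of `ε = δ ^ S * δ ^ S`, one factor is absorbed by the
  -- lower bound for the diagonal and the other, at most `δ`, goes into `τ`.
  have hετ : ε * K ≤ τ * (c * δ ^ S * (1 + |E|)) := by
    calc ε * K = K * (δ ^ S * δ ^ S) * 1 := by rw [← hδpow, two_mul, pow_add]; ring
      _ ≤ K * (δ * δ ^ S) * (1 + |E|) := by
          gcongr
          exact pow_le_of_le_one hδ0.le hδ1 hS0.ne'
      _ = τ * (c * δ ^ S * (1 + |E|)) := by
          rw [hτ]
          field_simp
  obtain ⟨hne, hlow⟩ := le_logMean_dirichletDet (ω := ω) hρ hv hW hε.le N hyρ hm hτ0 hτ2 hyb hετ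
  have hD := isStripAnalytic_dirichletDet (ε := ε) (ω := ω) (W := W) hv N E
  have hρ0 : |(0 : ℝ)| ≤ ρ := by simpa using hρ.le
  have hN0 : (0 : ℝ) < N := by exact_mod_cast hN
  have hne' : ∀ j, ∃ z ∈ closedStrip ρ, v j z - (E : ℂ) ≠ 0 := fun j =>
    ⟨_, line_mem_closedStrip hyρ 0, norm_pos_iff.1 (hm.trans_le (hyb 0 j))⟩
  set J : ℝ := ∑ j, logMean (fun z => v j z - (E : ℂ)) 0 with hJdef
  set L : ℝ := N * J - 2 * τ * (N * l) with hL
  set U : ℝ := (N * l) * (Real.log B + Real.log (1 + |E|)) with hU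
  have hLy : L ≤ logMean (dirichletDet ε ω W v N E) y := by
    refine le_trans ?_ hlow
    have h1 : J ≤ ∑ j, logMean (fun z => v j z - (E : ℂ)) y := Finset.sum_le_sum fun j _ =>
      (hv j).logMean_zero_le hy.1 (le_of_abs_le hyρ) E (hne' j)
    have h2 := mul_le_mul_of_nonneg_left h1 hN0.le
    linarith
  have hUy : ∀ y', |y'| ≤ ρ → logMean (dirichletDet ε ω W v N E) y' ≤ U := by
    intro y' hy'
    refine (hD.logMean_le_log hne hy' (B := (B * (1 + |E|)) ^ (N * l)) fun x => ?_).trans ?_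
    · refine (norm_dirichletDet_le hρ hW hε.le hε1 N hM E (line_mem_closedStrip hy' x)).trans ?_
      refine pow_le_pow_left₀ (by positivity) ?_ _
      nlinarith [abs_nonneg E]
    · rw [Real.log_pow, Real.log_mul (by positivity) (by positivity), hU]
      push_cast
      exact le_rfl
  have hmain := hD.sub_le_logMean_zero hne hy.1 (by linarith [hy.2]) hδ₀ρ hLy (hUy δ₀ hδ₀ρ')
    (hLy.trans (hUy y hyρ))
  have hJl : l * (Real.log (1 + |E|) - C₂) ≤ J := by
    have := Finset.sum_le_sum fun (j : Fin l) (_ : j ∈ Finset.univ) => hJ E j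
    rw [Finset.sum_const, Finset.card_univ, Fintype.card_fin, nsmul_eq_mul] at this
    exact this
  -- The lower bound `hJl` for `J` cancels the `log (1 + |E|)` in `U`, so `C₃` does not depend on
  -- `E`.
  have hUL : U - L ≤ N * l * C₃ := by
    have h1 := mul_le_mul_of_nonneg_left hJl hN0.le
    have h2 : 2 * τ * (N * l) ≤ 1 * (N * l) := by gcongr; linarith
    rw [hU, hL, hC₃]
    linarith
  have hfinal : 2 * y / δ₀ * (U - L) ≤ 2 * δ / δ₀ * (N * l * C₃) := by
    have : 0 ≤ U - L := by linarith [hLy.trans (hUy y hyρ)]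
    have := hy.1
    have := hy.2.le
    gcongr
  refine ⟨?_, ?_, fun j => ?_, ?_⟩
  · simpa using hD.ae_ne_zero hne hρ0
  · simpa using hD.intervalIntegrable_log hρ0 0 1
  · simpa using ((hv j).isStripAnalytic.sub_const E).intervalIntegrable_log hρ0 0 1
  · have h1 : (∫ x in (0 : ℝ)..1, Real.log ‖dirichletDet ε ω W v N E (x : ℂ)‖) =
        logMean (dirichletDet ε ω W v N E) 0 := by simp [logMean]
    have h2 : (∑ j, ∫ x in (0 : ℝ)..1, Real.log ‖v j (x : ℂ) - (E : ℂ)‖) = J := by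
      simp [hJdef, logMean]
    rw [h1, h2, ge_iff_le, one_div, le_inv_mul_iff₀ hN0]
    refine le_trans (le_of_eq ?_) ((sub_le_sub_left hfinal L).trans hmain)
    rw [hL, hτ]
    field_simp
    ring
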